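/- Let $p,q$ be nonzero integers with $|p|\neq|q|$ and let $G=BS(p,q)=\langle a,t\mid t^{-1}a^{p}t=a^{q}\rangle$ be the Baumslag–Solitar group, equipped with the word metric of a finite generating set. Let $\omega$ be an ultrafilter on $\mathbb N$, let $d=(d_n)$ be a sequence of positive real numbers with $\lim^{\omega}d_n=\infty$, and let $e=(e_n)$ be a sequence of points of $G$. The asymptotic cone $C=\operatorname{Con}^{\omega}(G,e,d)$ is the set of sequences $(x_n)$ in $G$ for which $\operatorname{dist}(x_n,e_n)/d_n$ is bounded $\omega$-almost surely, with the metric $\operatorname{dist}\bigl((x_n),(y_n)\bigr)=\lim^{\omega}\operatorname{dist}(x_n,y_n)/d_n$, where sequences at distance $0$ are identified (up to isometry $C$ does not depend on $e$). Then for every such $\omega$, $d$ and $e$, and every base point $x_0\in C$: (i) $C$ is not semilocally simply connected; (ii) $\pi_1(C,x_0)$ is not a simple group; (iii) whenever $\pi_1(C,x_0)$ is the free product of a family of its subgroups, at least one of these subgroups is uncountable and not free; (iv) $\pi_1(C,x_0)$ contains an uncountable free subgroup. -/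

import Mathlib

open Filter Topology

noncomputable section

/-- The two generators of a Baumslag–Solitar group. -/
inductive BSGen : Type
  | a : BSGen
  | t : BSGen

/-- The Baumslag–Solitar group `BS(p, q) = ⟨a, t | t⁻¹ a ^ p t = a ^ q⟩`. -/
abbrev BaumslagSolitar (p q : ℤ) : Type :=
  PresentedGroup
    ({(FreeGroup.of BSGen.t)⁻¹ * FreeGroup.of BSGen.a ^ p * FreeGroup.of BSGen.t *
      (FreeGroup.of BSGen.a ^ q)⁻¹} : Set (FreeGroup BSGen))

/-- A finite generating set of a group. -/
structure FiniteGeneratingSet (G : Type*) [Group G] where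
  carrier : Set G
  finite : carrier.Finite
  closure_eq_top : Subgroup.closure carrier = ⊤

namespace FiniteGeneratingSet

variable {G : Type*} [Group G]

/-- The Cayley graph of a group with respect to a generating set is connected. -/
theorem mulCayley_connected (S : FiniteGeneratingSet G) :
    (SimpleGraph.mulCayley S.carrier).Connected := by
  have step : ∀ (x s : G), s ∈ S.carrier →
      (SimpleGraph.mulCayley S.carrier).Reachable x (x * s) := by
    intro x s hs
    by_cases h : x = x * s
    · rw [← h]
    · exact SimpleGraph.Adj.reachable
        ((SimpleGraph.mulCayley_adj' _ _ _).2 ⟨h, s, hs, Or.inl rfl⟩)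
  have key : ∀ g : G, (SimpleGraph.mulCayley S.carrier).Reachable 1 g := by
    intro g
    have hg : g ∈ Subgroup.closure S.carrier := by rw [S.closure_eq_top]; trivial
    induction hg using Subgroup.closure_induction_right with
    | one => exact SimpleGraph.Reachable.refl _
    | mul_right x hx s hs ih => exact ih.trans (step x s hs)
    | mul_inv_cancel x hx s hs ih =>
      refine ih.trans ?_
      have := step (x * s⁻¹) s hs
      rw [inv_mul_cancel_right] at this
      exact this.symm
  haveI : Nonempty G := ⟨1⟩
  exact ⟨fun g h => (key g).symm.trans (key h)⟩

/-- The group `G`, regarded as the vertex set of its Cayley graph with respect to `S`; it carries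
the word metric of `S`. -/
def WordMetricSpace (_S : FiniteGeneratingSet G) : Type _ := G

/-- The word metric: the path metric of the Cayley graph, restricted to its vertices. -/
instance (S : FiniteGeneratingSet G) : MetricSpace S.WordMetricSpace where
  dist g h := ((SimpleGraph.mulCayley S.carrier).dist g h : ℝ)
  dist_self g := by
    exact_mod_cast SimpleGraph.dist_self (G := SimpleGraph.mulCayley S.carrier) (v := g)
  dist_comm g h := by
    exact_mod_cast SimpleGraph.dist_comm (G := SimpleGraph.mulCayley S.carrier) (u := g) (v := h)
  dist_triangle g h k := by
    exact_mod_cast S.mulCayley_connected.dist_triangle (u := g) (v := h) (w := k)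
  eq_of_dist_eq_zero {g h} hgh := by
    have h0 : (SimpleGraph.mulCayley S.carrier).dist g h = 0 := by exact_mod_cast hgh
    exact S.mulCayley_connected.dist_eq_zero_iff.1 h0

end FiniteGeneratingSet

/-- A scaling sequence for the ultrafilter `ω`: positive real numbers that diverge to infinity
`ω`-almost surely. (Hence `ω` is nonprincipal as soon as a scaling sequence exists.) -/
structure ScalingSequence (ω : Ultrafilter ℕ) where
  toFun : ℕ → ℝ
  pos : ∀ n, 0 < toFun n
  tendsto_atTop : Tendsto toFun (ω : Filter ℕ) atTop

section AsymptoticCone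

variable (X : Type*) [MetricSpace X] (ω : Ultrafilter ℕ) (d : ScalingSequence ω) (e : ℕ → X)

/-- The sequences `x` in `X` with `lim^ω dist (x n) (e n) / d n < ∞`, i.e. for which these rescaled
distances are `ω`-almost surely bounded. -/
def ConeSequence : Type _ :=
  {x : ℕ → X // ∃ M : ℝ, ∀ᶠ n in (ω : Filter ℕ), dist (x n) (e n) / d.toFun n < M}

variable {X ω d e}

/-- The `ω`-limit of the rescaled distances of two sequences. -/
def ConeSequence.limDist (x y : ConeSequence X ω d e) : ℝ :=
  limUnder (ω : Filter ℕ) fun n => dist (x.1 n) (y.1 n) / d.toFun n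

/-- The `ω`-limit in the definition of `ConeSequence.limDist` exists. -/
theorem ConeSequence.tendsto_limDist (x y : ConeSequence X ω d e) :
    Tendsto (fun n => dist (x.1 n) (y.1 n) / d.toFun n) (ω : Filter ℕ) (𝓝 (x.limDist y)) := by
  obtain ⟨M, hM⟩ := x.2
  obtain ⟨N, hN⟩ := y.2
  have hmem : ∀ᶠ n in (ω : Filter ℕ),
      dist (x.1 n) (y.1 n) / d.toFun n ∈ Set.Icc (0 : ℝ) (M + N) := by
    filter_upwards [hM, hN] with n h1 h2
    refine ⟨div_nonneg dist_nonneg (d.pos n).le, ?_⟩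
    calc dist (x.1 n) (y.1 n) / d.toFun n
        ≤ (dist (x.1 n) (e n) + dist (y.1 n) (e n)) / d.toFun n :=
          div_le_div_of_nonneg_right (dist_triangle_right _ _ _) (d.pos n).le
      _ = dist (x.1 n) (e n) / d.toFun n + dist (y.1 n) (e n) / d.toFun n := add_div _ _ _
      _ ≤ M + N := add_le_add h1.le h2.le
  obtain ⟨l, -, hl⟩ := (isCompact_Icc (a := (0 : ℝ)) (b := M + N)).ultrafilter_le_nhds
    (ω.map fun n => dist (x.1 n) (y.1 n) / d.toFun n) (le_principal_iff.2 hmem)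
  exact tendsto_nhds_limUnder ⟨l, hl⟩

instance : PseudoMetricSpace (ConeSequence X ω d e) where
  dist x y := x.limDist y
  dist_self x := by
    refine tendsto_nhds_unique (x.tendsto_limDist x) ?_
    simp
  dist_comm x y := by
    refine tendsto_nhds_unique (x.tendsto_limDist y) ?_
    simpa only [dist_comm] using y.tendsto_limDist x
  dist_triangle x y z := by
    refine le_of_tendsto_of_tendsto' (x.tendsto_limDist z)
      ((x.tendsto_limDist y).add (y.tendsto_limDist z)) fun n => ?_
    rw [← add_div]
    exact div_le_div_of_nonneg_right (dist_triangle _ _ _) (d.pos n).le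

variable (X ω d e)

/-- The asymptotic cone `Con^ω(X, e, d)`: the quotient of the pseudometric space of sequences at
finite rescaled distance from `e` by the relation of being at distance `0`; it is a metric space
with the induced metric. -/
abbrev AsymptoticCone : Type _ := SeparationQuotient (ConeSequence X ω d e)

end AsymptoticCone

/-- Every point `x` has a neighbourhood `U` such that `π₁(U, x) → π₁(X, x)` is trivial. -/
def IsSemilocallySimplyConnected (X : Type*) [TopologicalSpace X] : Prop :=
  ∀ x : X, ∃ U ∈ 𝓝 x, ∀ γ : Path x x, Set.range γ ⊆ U → γ.Homotopic (Path.refl x)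

/-- The group `G` is the (internal) free product of its subgroups `H i`. -/
def IsInternalFreeProduct {G : Type*} [Group G] {ι : Type*} (H : ι → Subgroup G) : Prop :=
  Function.Bijective (Monoid.CoprodI.lift (fun i => (H i).subtype) :
    Monoid.CoprodI (fun i => H i) →* G)

end

/-! Exchanging `t` and `t⁻¹`, one may assume |p| < |q|. Put Λ = |q/p| and c = log Λ. The relation
a^q t⁻¹ = t⁻¹ a^p lets a power a^N with q ∣ N and |N| of order Λ^m be reached from 1 in O(m) steps:
the base-q/p expansion of N leads down to depth m in the branch of the Bass–Serre tree that starts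
with t⁻¹, and powers of t lead back up (`exists_branch_path`). The left translate of this path by a
runs from a to a^(N+1) in another branch. With m ≈ κ d_k the two paths close up to a loop of size
O(κ) in the cone, at any base point.

These loops are told apart by a homomorphism from the fundamental group to a free group. The cone is
covered by the open sets A = {depth < δ} and B = {depth > 0}. The affine action a : x ↦ x + 1, t : x
↦ (p/q)x gives every group element a horizontal position. At depth ρ < δ d_k inside the branch, a
short step moves the position by little more than Λ^ρ, so the position modulo errors of exponential
rate below cδ is locally constant on A ∩ B. Used as the transition function of a principal bundle
whose structure group is the free group on the position classes, it yields the monodromy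
homomorphism Φ (`exists_fundamentalGroup_hom`). Since κ > δ, the choices N ≈ qθ exp(cκ d_k), θ ∈ [0,
1], give loops with pairwise different values σ(θ)⁻¹ s (`exists_small_loops`).

Hence arbitrarily small loops are essential, and the image of Φ is uncountable. That image is free,
so it lifts to an uncountable free subgroup. Composing Φ with an exponent sum gives a nontrivial map
to ℤ, whose kernel is proper, and nontrivial because the group is uncountable.

For free decompositions: if every factor were free or countable, the fundamental group would embed
in a free product of countable groups. Infinite products of shrinking loops solve the equations y_n
= y_{n+1}⁻¹ l_n y_{n+1} for all small l_n, and in a free product of countable groups this forces the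
loops of some scale to have countable image (`exists_countable_map`). But the loops of each scale
have uncountably many classes. -/

/-- `a` and `t` generate `G`, and `G` is presented by the Baumslag–Solitar relation. -/
structure IsBaumslagSolitar {G : Type} [Group G] (p q : ℤ) (a t : G) : Prop where
  closure_eq_top : Subgroup.closure {a, t} = ⊤
  rel : t⁻¹ * a ^ p * t = a ^ q
  exists_hom : ∀ {Q : Type} [Group Q] (x y : Q), y⁻¹ * x ^ p * y = x ^ q →
    ∃ f : G →* Q, f a = x ∧ f t = y

theorem IsBaumslagSolitar.presentedGroup (p q : ℤ) :
    IsBaumslagSolitar (G := BaumslagSolitar p q) p q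
      (PresentedGroup.of BSGen.a) (PresentedGroup.of BSGen.t) where
  closure_eq_top := by
    rw [← PresentedGroup.closure_range_of]
    congr 1
    ext x
    constructor
    · rintro (rfl | rfl)
      exacts [⟨_, rfl⟩, ⟨_, rfl⟩]
    · rintro ⟨_ | _, rfl⟩
      exacts [Or.inl rfl, Or.inr rfl]
  rel := by
    rw [← mul_inv_eq_one]
    exact PresentedGroup.one_of_mem (Set.mem_singleton _)
  exists_hom {Q} _ x y h := by
    let f : BSGen → Q := fun g => BSGen.casesOn g x y
    have hf : ∀ r ∈ ({(FreeGroup.of BSGen.t)⁻¹ * FreeGroup.of BSGen.a ^ p * FreeGroup.of BSGen.t *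
        (FreeGroup.of BSGen.a ^ q)⁻¹} : Set (FreeGroup BSGen)), FreeGroup.lift f r = 1 := by
      rintro r rfl
      simpa [f, mul_inv_eq_one] using h
    exact ⟨PresentedGroup.toGroup hf, PresentedGroup.toGroup.of hf, PresentedGroup.toGroup.of hf⟩

/-- This reduces the theorem to |p| < |q|. It is the reason for working with a predicate on (G, a,
t): the same group serves for (q, p), so neither the metric nor the cone has to be transported. -/
theorem IsBaumslagSolitar.swap {G : Type} [Group G] {p q : ℤ} {a t : G}
    (h : IsBaumslagSolitar p q a t) : IsBaumslagSolitar q p a t⁻¹ where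
  closure_eq_top := by
    rw [eq_top_iff, ← h.closure_eq_top, Subgroup.closure_le]
    rintro x (rfl | rfl)
    · exact Subgroup.subset_closure (Or.inl rfl)
    · exact inv_mem_iff.1 (Subgroup.subset_closure (Or.inr rfl))
  rel := by
    rw [← h.rel]; group
  exists_hom {Q} _ x y hxy := by
    obtain ⟨f, hfa, hft⟩ := h.exists_hom x y⁻¹ (by rw [← hxy]; group)
    exact ⟨f, hfa, by rw [map_inv, hft, inv_inv]⟩

theorem IsBaumslagSolitar.induction {G : Type} [Group G] {p q : ℤ} {a t : G}
    (hB : IsBaumslagSolitar p q a t) {P : G → Prop} (ha : P a) (ht : P t) (h1 : P 1)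
    (hmul : ∀ x y, P x → P y → P (x * y)) (hinv : ∀ x, P x → P x⁻¹) (g : G) : P g := by
  have hg : g ∈ Subgroup.closure {a, t} := by rw [hB.closure_eq_top]; trivial
  induction hg using Subgroup.closure_induction with
  | mem x hx =>
    rcases hx with rfl | rfl
    exacts [ha, ht]
  | one => exact h1
  | mul x y _ _ hx hy => exact hmul x y hx hy
  | inv x _ hx => exact hinv x hx

/-! ### Normal forms, depth in a branch of the Bass–Serre tree, and the affine action -/

namespace BaumslagSolitar

section NormalForm

variable (p q : ℤ)

/-- The modulus of the digits that follow a letter `t` (`true`) or `t⁻¹` (`false`). -/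
def modulus : Bool → ℤ
  | true => q
  | false => p

/-- Reduced sequences of syllables `t^{±1} a^r`. -/
def IsReduced : List (Bool × ℤ) → Prop
  | [] => True
  | (b, r) :: l => (0 ≤ r ∧ r < |modulus p q b|) ∧ (∀ x ∈ l.head?, r = 0 → x.1 = b) ∧ IsReduced l

/-- Left multiplication of the normal form `a^n * l` by `t` (`true`) or `t⁻¹` (`false`). -/
def stepAux (b : Bool) : ℤ × List (Bool × ℤ) → ℤ × List (Bool × ℤ)
  | (n, []) => (modulus p q (!b) * (n / modulus p q b), [(b, n % modulus p q b)])
  | (n, (b', r) :: l) =>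
    if b' = !b ∧ n % modulus p q b = 0 then (modulus p q (!b) * (n / modulus p q b) + r, l)
    else (modulus p q (!b) * (n / modulus p q b), (b, n % modulus p q b) :: (b', r) :: l)

variable {p q}

theorem modulus_ne_zero (hp : p ≠ 0) (hq : q ≠ 0) (b : Bool) : modulus p q b ≠ 0 := by
  cases b <;> assumption

theorem isReduced_stepAux (hp : p ≠ 0) (hq : q ≠ 0) (b : Bool) {x : ℤ × List (Bool × ℤ)}
    (hx : IsReduced p q x.2) : IsReduced p q (stepAux p q b x).2 := by
  have hm := modulus_ne_zero hp hq b
  have hr : 0 ≤ x.1 % modulus p q b ∧ x.1 % modulus p q b < |modulus p q b| :=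
    ⟨Int.emod_nonneg _ hm, Int.emod_lt_abs _ hm⟩
  rcases x with ⟨n, _ | ⟨⟨b', r⟩, l⟩⟩
  · exact ⟨hr, by simp, trivial⟩
  · simp only [stepAux]
    split_ifs with h
    · exact hx.2.2
    · refine ⟨hr, ?_, hx⟩
      rintro y hy h0
      obtain rfl : (b', r) = y := by simpa using hy
      by_contra hb
      refine h ⟨?_, h0⟩
      cases b <;> cases b' <;> simp_all

/-- Undoing a new syllable is a cancellation. Undoing a cancellation has to restore the syllable:
the range of the digits recovers r uniquely, and reducedness excludes a second cancellation when r =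
0. -/
theorem stepAux_not (hp : p ≠ 0) (hq : q ≠ 0) (b : Bool) {x : ℤ × List (Bool × ℤ)}
    (hx : IsReduced p q x.2) : stepAux p q (!b) (stepAux p q b x) = x := by
  have hm := modulus_ne_zero hp hq b
  have hm' := modulus_ne_zero hp hq (!b)
  rcases x with ⟨n, _ | ⟨⟨b', r⟩, l⟩⟩
  · simp [stepAux, hm', Int.mul_ediv_add_emod]
  · rw [stepAux]
    split_ifs with h
    · obtain ⟨rfl, h0⟩ := h
      obtain ⟨⟨hr0, hr1⟩, hl, -⟩ := hx
      have h1 : (modulus p q (!b) * (n / modulus p q b) + r) / modulus p q (!b) =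
          n / modulus p q b := by
        rw [Int.mul_add_ediv_left _ _ hm', Int.ediv_eq_zero_of_lt_abs hr0 hr1, add_zero]
      have h2 : (modulus p q (!b) * (n / modulus p q b) + r) % modulus p q (!b) = r := by
        rw [Int.mul_add_emod_self_left, Int.emod_eq_iff hm']
        exact ⟨hr0, by simpa using hr1, by simp⟩
      have h3 : modulus p q b * (n / modulus p q b) = n := by
        have := Int.mul_ediv_add_emod n (modulus p q b)
        omega
      rcases l with _ | ⟨⟨b', r'⟩, l⟩
      · simp [stepAux, h1, h2, h3]
      · have : ¬ (b' = b ∧ r = 0) := by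
          rintro ⟨rfl, h⟩
          have := hl _ rfl h
          simp at this
        simp [stepAux, h1, h2, h3, this]
    · simp [stepAux, hm', Int.mul_ediv_add_emod]

/-- This is the relation t a^(qk) = a^(pk) t, and its inverse form, on normal forms. -/
theorem stepAux_add_mul (hp : p ≠ 0) (hq : q ≠ 0) (b : Bool) (n k : ℤ) (l : List (Bool × ℤ)) :
    stepAux p q b (n + modulus p q b * k, l) =
      ((stepAux p q b (n, l)).1 + modulus p q (!b) * k, (stepAux p q b (n, l)).2) := by
  have hm := modulus_ne_zero hp hq b
  rcases l with _ | ⟨⟨b', r⟩, l⟩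
  · simp [stepAux, Int.add_mul_ediv_left _ _ hm, mul_add]
  · simp only [stepAux, Int.add_mul_ediv_left _ _ hm, Int.add_mul_emod_self_left, mul_add]
    split_ifs
    · simp; ring
    · simp

variable (p q)

/-- The normal forms of the elements of the Baumslag–Solitar group. -/
abbrev NormalForm : Type := {x : ℤ × List (Bool × ℤ) // IsReduced p q x.2}

variable {p q}

/-- The generator `t` acts on normal forms. -/
def stepPerm (hp : p ≠ 0) (hq : q ≠ 0) : Equiv.Perm (NormalForm p q) where
  toFun x := ⟨stepAux p q true x.1, isReduced_stepAux hp hq _ x.2⟩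
  invFun x := ⟨stepAux p q false x.1, isReduced_stepAux hp hq _ x.2⟩
  left_inv x := Subtype.ext (stepAux_not hp hq true x.2)
  right_inv x := Subtype.ext (stepAux_not hp hq false x.2)

/-- The generator `a` acts on normal forms. -/
def shiftPerm : Equiv.Perm (NormalForm p q) where
  toFun x := ⟨(x.1.1 + 1, x.1.2), x.2⟩
  invFun x := ⟨(x.1.1 - 1, x.1.2), x.2⟩
  left_inv x := Subtype.ext (by simp)
  right_inv x := Subtype.ext (by simp)

theorem shiftPerm_zpow_apply (n : ℤ) (x : NormalForm p q) :
    (shiftPerm ^ n) x = ⟨(x.1.1 + n, x.1.2), x.2⟩ := by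
  induction n generalizing x with
  | zero => exact Subtype.ext (by simp)
  | succ n ih =>
    rw [zpow_add_one, Equiv.Perm.mul_apply, ih]
    refine Subtype.ext (Prod.ext ?_ rfl)
    change x.1.1 + 1 + (n : ℤ) = x.1.1 + ((n : ℤ) + 1)
    ring
  | pred n ih =>
    rw [zpow_sub_one, Equiv.Perm.mul_apply, ih]
    refine Subtype.ext (Prod.ext ?_ rfl)
    change x.1.1 - 1 + -(n : ℤ) = x.1.1 + (-(n : ℤ) - 1)
    ring

theorem stepPerm_rel (hp : p ≠ 0) (hq : q ≠ 0) :
    (stepPerm hp hq)⁻¹ * shiftPerm ^ p * stepPerm hp hq = shiftPerm ^ q := by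
  rw [mul_assoc, inv_mul_eq_iff_eq_mul]
  ext1 x
  simp only [Equiv.Perm.mul_apply, shiftPerm_zpow_apply]
  refine Subtype.ext ?_
  have := stepAux_add_mul hp hq true x.1.1 1 x.1.2
  simp only [mul_one] at this
  exact this.symm

/-- The sum of the signs of the syllables. -/
def signSum (l : List (Bool × ℤ)) : ℤ := (l.map fun x => if x.1 then (1 : ℤ) else -1).sum

/-- The number of syllables, if the last one is `t`, and `0` otherwise. -/
def branchLength (l : List (Bool × ℤ)) : ℤ := if l.getLast? = some (true, 0) then l.length else 0

theorem branchLength_nonneg (l : List (Bool × ℤ)) : 0 ≤ branchLength l := by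
  unfold branchLength; split_ifs <;> simp

theorem signSum_le_length (l : List (Bool × ℤ)) : signSum l ≤ l.length := by
  induction l with
  | nil => simp [signSum]
  | cons x l ih =>
    simp only [signSum, List.map_cons, List.sum_cons, List.length_cons] at ih ⊢
    push_cast
    split_ifs <;> omega

theorem signSum_le_branchLength {l : List (Bool × ℤ)} (h : 0 < branchLength l) :
    signSum l ≤ branchLength l := by
  unfold branchLength at h ⊢
  split_ifs at h ⊢
  · exact signSum_le_length l
  · omega

/-- A syllable put in front of a nonempty list leaves the last one alone. The bound makes the depth
Lipschitz. -/
theorem branchLength_cons (x : Bool × ℤ) (l : List (Bool × ℤ)) :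
    |branchLength (x :: l) - branchLength l| ≤ 1 := by
  rcases l with _ | ⟨y, l⟩
  · simp only [branchLength]
    split_ifs <;> simp
  · simp only [branchLength, List.getLast?_cons_cons]
    split_ifs <;> simp

theorem branchLength_stepAux (b : Bool) (x : ℤ × List (Bool × ℤ)) :
    |branchLength (stepAux p q b x).2 - branchLength x.2| ≤ 1 := by
  rcases x with ⟨n, _ | ⟨⟨b', r⟩, l⟩⟩
  · exact branchLength_cons _ _
  · simp only [stepAux]
    split_ifs
    · rw [abs_sub_comm]
      exact branchLength_cons _ _
    · exact branchLength_cons _ _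

theorem signSum_stepAux (x : ℤ × List (Bool × ℤ)) :
    signSum (stepAux p q true x).2 = 1 + signSum x.2 := by
  rcases x with ⟨n, _ | ⟨⟨b', r⟩, l⟩⟩
  · rfl
  · simp only [stepAux]
    split_ifs with h
    · simp [signSum, h.1]
    · simp [signSum]

theorem exists_stepAux_eq_cons (n : ℤ) {l : List (Bool × ℤ)} (hl : ∀ x ∈ l.head?, x.1 = true) :
    stepAux p q true (n, l) = (p * (n / q), (true, n % q) :: l) := by
  rcases l with _ | ⟨⟨b', r⟩, l⟩
  · rfl
  · have : b' = true := hl _ rfl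
    simp [stepAux, this, modulus]

/-- Multiplying a word that begins with t by t never cancels, so the digit made by the first step
stays at the end. -/
theorem iterate_stepAux (n : ℤ) (i : ℕ) : ∃ (m : ℤ) (l : List (Bool × ℤ)),
    (stepAux p q true)^[i] (n, []) = (m, l) ∧ l.length = i ∧ (∀ x ∈ l.head?, x.1 = true) ∧
      (0 < i → l.getLast? = some (true, n % q)) := by
  induction i with
  | zero => exact ⟨n, [], rfl, rfl, by simp, by simp⟩
  | succ i ih =>
    obtain ⟨m, l, h1, h2, h3, h4⟩ := ih
    refine ⟨_, _, by rw [Function.iterate_succ_apply', h1, exists_stepAux_eq_cons m h3],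
      by simp [h2], by simp, fun _ => ?_⟩
    rcases Nat.eq_zero_or_pos i with rfl | hi
    · obtain rfl : l = [] := List.length_eq_zero_iff.1 h2
      obtain rfl : n = m := by simpa using congrArg Prod.fst h1
      rfl
    · rcases l with _ | ⟨y, l⟩
      · simp at h2; omega
      · rw [List.getLast?_cons_cons, h4 hi]

/-- The height homomorphism and the depth of an element of `G` in the branch of the Bass–Serre tree
that starts with `t⁻¹`. -/
theorem exists_branchDepth {G : Type} [Group G] {a t : G} (hB : IsBaumslagSolitar p q a t)
    (hp : p ≠ 0) (hq : q ≠ 0) : ∃ (h : G →* Multiplicative ℤ) (ρ : G → ℤ),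
    h a = 1 ∧ h t = Multiplicative.ofAdd 1 ∧ ρ 1 = 0 ∧ (∀ g, 0 ≤ ρ g) ∧
    (∀ g, ρ (g * a) = ρ g) ∧ (∀ g, |ρ (g * t) - ρ g| ≤ 1) ∧
    (∀ g, 0 < ρ g → -ρ g ≤ (h g).toAdd) ∧
    (∀ (N : ℤ) (i : ℕ), q ∣ N → ρ (a ^ N * t⁻¹ ^ i) = i) ∧
    (1 < |q| → ∀ (N : ℤ) (i : ℕ), q ∣ N → ρ (a ^ (N + 1) * t⁻¹ ^ i) = 0) := by
  obtain ⟨h, ha, ht⟩ := hB.exists_hom (1 : Multiplicative ℤ) (Multiplicative.ofAdd 1) (by simp)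
  obtain ⟨f, fa, ft⟩ := hB.exists_hom _ _ (stepPerm_rel hp hq)
  let v : NormalForm p q := ⟨(0, []), trivial⟩
  have hsum : ∀ g x, signSum (f g x).1.2 = (h g).toAdd + signSum x.1.2 := by
    intro g
    induction g using hB.induction with
    | ha => intro x; rw [fa, ha, toAdd_one, zero_add]; rfl
    | ht => intro x; rw [ft, ht]; exact signSum_stepAux x.1
    | h1 => simp
    | hmul x y hx hy => intro z; simp [hx, hy, add_assoc]
    | hinv x hx =>
      intro z
      have := hx (f x⁻¹ z)
      rw [← Equiv.Perm.mul_apply, ← map_mul, mul_inv_cancel, map_one, Equiv.Perm.one_apply] at this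
      rw [this]; simp
  have hpow : ∀ (N : ℤ) (i : ℕ), (f (a ^ N * t⁻¹ ^ i)⁻¹ v).1 =
      (stepAux p q true)^[i] (-N, []) := by
    intro N i
    have h1 : (a ^ N * t⁻¹ ^ i)⁻¹ = t ^ i * a ^ (-N) := by simp
    rw [h1, map_mul, map_pow, map_zpow, fa, ft, Equiv.Perm.mul_apply]
    clear h1
    induction i with
    | zero =>
      rw [pow_zero, Equiv.Perm.one_apply, shiftPerm_zpow_apply]
      simp [v]
    | succ i ih =>
      rw [pow_succ', Equiv.Perm.mul_apply, Function.iterate_succ_apply', ← ih]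
      rfl
  -- Here f g⁻¹ v is the normal form of g⁻¹. Passing to the inverse turns right multiplication of g
  -- into left multiplication, which acts on the front of the list, and turns an initial t⁻¹ of g
  -- into a final syllable (true, 0).
  refine ⟨h, fun g => branchLength (f g⁻¹ v).1.2, ha, ht, ?_, fun g => branchLength_nonneg _,
    fun g => ?_, fun g => ?_, fun g hg => ?_, fun N i hN => ?_, fun hq1 N i hN => ?_⟩
  · simp [branchLength, v]
  · have : f (g * a)⁻¹ v = (shiftPerm ^ (-1 : ℤ) : Equiv.Perm _) (f g⁻¹ v) := by
      rw [mul_inv_rev, map_mul, map_inv, fa, Equiv.Perm.mul_apply]; rfl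
    simp only [this, shiftPerm_zpow_apply]
  · have : f (g * t)⁻¹ v = (stepPerm hp hq)⁻¹ (f g⁻¹ v) := by
      rw [mul_inv_rev, map_mul, map_inv, ft, Equiv.Perm.mul_apply]
    simp only [this]
    exact branchLength_stepAux false _
  · have h1 := signSum_le_branchLength hg
    rw [hsum g⁻¹ v] at h1
    have h2 : signSum v.1.2 = 0 := rfl
    rw [map_inv h, toAdd_inv, h2, add_zero] at h1
    exact neg_le.1 h1
  · simp only [hpow]
    obtain ⟨m, l, h1, h2, -, h4⟩ := iterate_stepAux (p := p) (q := q) (-N) i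
    rw [h1]
    rcases Nat.eq_zero_or_pos i with rfl | hi
    · obtain rfl : l = [] := List.length_eq_zero_iff.1 h2
      simp [branchLength]
    · have : -N % q = 0 := Int.emod_eq_zero_of_dvd hN.neg_right
      simp [branchLength, h4 hi, this, h2]
  · simp only [hpow]
    obtain ⟨m, l, h1, h2, -, h4⟩ := iterate_stepAux (p := p) (q := q) (-(N + 1)) i
    rw [h1]
    rcases Nat.eq_zero_or_pos i with rfl | hi
    · obtain rfl : l = [] := List.length_eq_zero_iff.1 h2
      simp [branchLength]
    · have : -(N + 1) % q ≠ 0 := by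
        intro h0
        have h5 : q ∣ N + 1 := (dvd_neg.1 (Int.dvd_of_emod_eq_zero h0))
        have h6 : q ∣ 1 := (dvd_add_right hN).1 h5
        have h7 := Int.le_of_dvd one_pos ((abs_dvd _ _).2 h6)
        omega
      rw [branchLength, h4 hi, if_neg (by simpa using this)]

end NormalForm

/-- The orbit map of the affine action `a : x ↦ x + 1`, `t : x ↦ (p / q) x`. -/
theorem exists_position {G : Type} [Group G] {p q : ℤ} {a t : G}
    (hB : IsBaumslagSolitar p q a t) (hp : p ≠ 0) (hq : q ≠ 0) {h : G →* Multiplicative ℤ}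
    (ha : h a = 1) (ht : h t = Multiplicative.ofAdd 1) : ∃ pos : G → ℝ, pos a = 1 ∧ pos t = 0 ∧
    ∀ g u, pos (g * u) = pos g + ((p : ℝ) / q) ^ (h g).toAdd * pos u := by
  have hp' : (p : ℝ) ≠ 0 := by exact_mod_cast hp
  have hq' : (q : ℝ) ≠ 0 := by exact_mod_cast hq
  have hpq : (p : ℝ) / q ≠ 0 := div_ne_zero hp' hq'
  have hadd : ∀ (n : ℤ) (x : ℝ), ((Equiv.addRight (1 : ℝ)) ^ n) x = x + n := by
    intro n
    induction n with
    | zero => simp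
    | succ n ih => intro x; rw [zpow_add_one, Equiv.Perm.mul_apply, ih]; simp; ring
    | pred n ih =>
      intro x
      rw [zpow_sub_one, Equiv.Perm.mul_apply, ih]
      change x + -1 + _ = _
      push_cast; ring
  obtain ⟨f, fa, ft⟩ := hB.exists_hom (Equiv.addRight (1 : ℝ)) (Equiv.mulLeft₀ _ hpq) (by
    rw [mul_assoc, inv_mul_eq_iff_eq_mul]
    ext x
    simp only [Equiv.Perm.mul_apply, hadd, Equiv.mulLeft₀_apply]
    field_simp)
  -- Every element acts affinely, with slope (p/q) to the power of its height.
  have key : ∀ g x, f g x = f g 0 + ((p : ℝ) / q) ^ (h g).toAdd * x := by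
    intro g
    induction g using hB.induction with
    | ha => intro x; rw [fa, ha]; simp [add_comm]
    | ht => intro x; rw [ft, ht]; simp
    | h1 => simp
    | hmul x y hx hy =>
      intro z
      rw [map_mul, Equiv.Perm.mul_apply, Equiv.Perm.mul_apply, hx, hx (f y 0), hy, map_mul,
        toAdd_mul, zpow_add₀ hpq]
      ring
    | hinv x hx =>
      intro z
      have inj := (f x).injective
      apply inj
      rw [hx (_ + _), mul_add, ← add_assoc, ← hx, ← Equiv.Perm.mul_apply, ← Equiv.Perm.mul_apply,
        ← map_mul, mul_inv_cancel, map_one, ← mul_assoc, ← zpow_add₀ hpq, ← toAdd_mul, ← map_mul,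
        mul_inv_cancel, map_one]
      simp
  refine ⟨fun g => f g 0, by simp [fa], by simp [ft], fun g u => ?_⟩
  simp only [map_mul, Equiv.Perm.mul_apply]
  exact key _ _

end BaumslagSolitar

/-! ### Free factors and countability in free products of countable groups -/

namespace Monoid.CoprodI

variable {ι : Type*} {K : ι → Type*} [∀ i, Group (K i)]

namespace NeWord

theorem toList_eq_of_prod_eq {i j k l : ι} {w : NeWord K i j} {w' : NeWord K k l}
    (h : w.prod = w'.prod) : w.toList = w'.toList := by
  classical
  have := Word.equiv.symm.injective (a₁ := w.toWord) (a₂ := w'.toWord) h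
  exact congrArg Word.toList this

theorem fst_eq_of_prod_eq {i j k l : ι} {w : NeWord K i j} {w' : NeWord K k l}
    (h : w.prod = w'.prod) : i = k := by
  have := congrArg List.head? (toList_eq_of_prod_eq h)
  rw [toList_head?, toList_head?] at this
  exact congrArg Sigma.fst (Option.some_injective _ this)

theorem snd_eq_of_prod_eq {i j k l : ι} {w : NeWord K i j} {w' : NeWord K k l}
    (h : w.prod = w'.prod) : j = l := by
  have := congrArg List.getLast? (toList_eq_of_prod_eq h)
  rw [toList_getLast?, toList_getLast?] at this
  exact congrArg Sigma.fst (Option.some_injective _ this)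

theorem prod_ne_one {i j : ι} (w : NeWord K i j) : w.prod ≠ 1 := by
  classical
  intro h
  have := Word.equiv.symm.injective (a₁ := w.toWord) (a₂ := Word.empty) h
  exact w.toList_ne_nil (congrArg Word.toList this)

theorem exists_prod_eq {x : CoprodI K} (hx : x ≠ 1) :
    ∃ (i j : ι) (w : NeWord K i j), w.prod = x := by
  classical
  obtain ⟨i, j, w, hw⟩ := of_word (Word.equiv x) (fun h => hx (by
    rw [← Word.equiv.symm_apply_apply x, h]; rfl))
  exact ⟨i, j, w, by rw [prod, hw]; exact Word.equiv.symm_apply_apply x⟩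

end NeWord

/-- The free factor generated by the factors with index in `J`. -/
def freeFactor (K : ι → Type*) [∀ i, Group (K i)] (J : Set ι) : Subgroup (CoprodI K) :=
  (lift fun i : J => (of : K i →* CoprodI K)).range

theorem of_mem_freeFactor {J : Set ι} {i : ι} (hi : i ∈ J) (x : K i) :
    (of x : CoprodI K) ∈ freeFactor K J :=
  ⟨@of J (fun i => K i) _ ⟨i, hi⟩ x, lift_of _ _⟩

theorem freeFactor_le {J : Set ι} {S : Subgroup (CoprodI K)}
    (h : ∀ i ∈ J, ∀ x : K i, (of x : CoprodI K) ∈ S) : freeFactor K J ≤ S := by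
  refine lift_range_le _ _ ?_
  rintro ⟨i, hi⟩ - ⟨x, rfl⟩
  exact h i hi x

theorem freeFactor_mono {J J' : Set ι} (h : J ⊆ J') : freeFactor K J ≤ freeFactor K J' :=
  freeFactor_le fun _ hi x => of_mem_freeFactor (h hi) x

theorem countable_freeFactor [∀ i, Countable (K i)] {J : Set ι} (hJ : J.Countable) :
    Countable (freeFactor K J) := by
  have : Countable J := hJ
  have : Countable (CoprodI fun i : J => K i) := by
    have : Countable (FreeMonoid (Σ i : J, K i)) :=
      inferInstanceAs (Countable (List (Σ i : J, K i)))
    exact (Con.mk'_surjective (c := conGen (Rel fun i : J => K i))).countable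
  exact (MonoidHom.rangeRestrict_surjective _).countable

theorem exists_finite_mem_freeFactor (x : CoprodI K) :
    ∃ J : Set ι, J.Finite ∧ x ∈ freeFactor K J := by
  induction x using induction_on with
  | one => exact ⟨∅, Set.finite_empty, one_mem _⟩
  | of i m => exact ⟨{i}, Set.finite_singleton i, of_mem_freeFactor (Set.mem_singleton i) m⟩
  | mul x y hx hy =>
    obtain ⟨J, hJ, hx⟩ := hx
    obtain ⟨J', hJ', hy⟩ := hy
    exact ⟨J ∪ J', hJ.union hJ', mul_mem (freeFactor_mono Set.subset_union_left hx)
      (freeFactor_mono Set.subset_union_right hy)⟩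

theorem exists_neWord_of_mem_freeFactor {J : Set ι} {x : CoprodI K} (hx : x ∈ freeFactor K J)
    (h1 : x ≠ 1) : ∃ i ∈ J, ∃ j ∈ J, ∃ w : NeWord K i j, w.prod = x := by
  obtain ⟨y, rfl⟩ := hx
  obtain ⟨i, j, w, rfl⟩ := NeWord.exists_prod_eq (x := y) (by rintro rfl; simp at h1)
  suffices ∃ w' : NeWord K i j, w'.prod = lift (fun i : J => (of : K i →* CoprodI K)) w.prod from
    ⟨i, i.2, j, j.2, this⟩
  clear h1
  induction w with
  | singleton x hx => exact ⟨.singleton x hx, by simp⟩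
  | append w₁ hne w₂ h₁ h₂ =>
    obtain ⟨w₁', h₁⟩ := h₁
    obtain ⟨w₂', h₂⟩ := h₂
    exact ⟨w₁'.append (Subtype.coe_injective.ne hne) w₂', by simp [h₁, h₂]⟩

theorem NeWord.prod_notMem_freeFactor {J : Set ι} {i j : ι} (w : NeWord K i j) (hi : i ∉ J) :
    w.prod ∉ freeFactor K J := by
  intro h
  obtain ⟨k, hk, l, -, w', h'⟩ := exists_neWord_of_mem_freeFactor h w.prod_ne_one
  exact hi (fst_eq_of_prod_eq h' ▸ hk)

theorem NeWord.exists_eq_mul_left {J : Set ι} {i j : ι} (w : NeWord K i j)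
    (h : w.prod ∉ freeFactor K J) : ∃ a ∈ freeFactor K J, ∃ k ∉ J, ∃ w' : NeWord K k j,
    w.prod = a * w'.prod := by
  induction w with
  | @singleton i x hx =>
    exact ⟨1, one_mem _, i, fun hi => h (by simpa using of_mem_freeFactor hi x),
      .singleton x hx, by simp⟩
  | append w₁ hne w₂ h₁ h₂ =>
    by_cases h' : w₁.prod ∈ freeFactor K J
    · obtain ⟨a, ha, k, hk, w', hw⟩ := h₂ fun h2 => h (by simpa using mul_mem h' h2)
      exact ⟨w₁.prod * a, mul_mem h' ha, k, hk, w', by simp [hw, mul_assoc]⟩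
    · obtain ⟨a, ha, k, hk, w', hw⟩ := h₁ h'
      exact ⟨a, ha, k, hk, w'.append hne w₂, by simp [hw, mul_assoc]⟩

/-- A prefix and a suffix from the free factor are stripped off until a reduced word remains whose
first and last letters have index outside J. -/
theorem exists_eq_mul_neWord_mul {J : Set ι} {x : CoprodI K} (hx : x ∉ freeFactor K J) :
    ∃ a ∈ freeFactor K J, ∃ b ∈ freeFactor K J, ∃ k ∉ J, ∃ l ∉ J, ∃ w : NeWord K k l,
      x = a * w.prod * b := by
  obtain ⟨i, j, w, rfl⟩ := NeWord.exists_prod_eq (x := x) (by rintro rfl; exact hx (one_mem _))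
  obtain ⟨a, ha, k, hk, w₁, h₁⟩ := w.exists_eq_mul_left hx
  obtain ⟨b, hb, l, hl, w₂, h₂⟩ := w₁.inv.exists_eq_mul_left (J := J) (fun h => hx (by
    rw [NeWord.inv_prod, inv_mem_iff] at h
    exact h₁ ▸ mul_mem ha h))
  refine ⟨a, ha, b⁻¹, inv_mem hb, k, hk, l, hl, w₂.inv, ?_⟩
  rw [NeWord.inv_prod] at h₂ ⊢
  rw [h₁, mul_assoc, ← mul_inv_rev, ← h₂, inv_inv]

/-- The conjugate of an element of a free factor by a reduced word is a reduced word. -/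
theorem exists_neWord_conj {J : Set ι} {c : CoprodI K} (hc : c ∈ freeFactor K J) (h1 : c ≠ 1)
    {k l : ι} (hl : l ∉ J) (w : NeWord K k l) :
    ∃ w' : NeWord K k k, w'.prod = w.prod * c * w.prod⁻¹ := by
  obtain ⟨i, hi, j, hj, v, rfl⟩ := exists_neWord_of_mem_freeFactor hc h1
  exact ⟨(w.append (fun h : l = i => hl (h ▸ hi)) v).append (fun h : j = l => hl (h ▸ hj)) w.inv, by simp⟩

/-- If y⁻¹ = a w b with w beginning and ending outside J, then w (b c b⁻¹) w⁻¹ is reduced as written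
and begins outside J, so it is not in the free factor. -/
theorem freeFactor_malnormal {J : Set ι} {c y : CoprodI K} (hc : c ∈ freeFactor K J) (h1 : c ≠ 1)
    (h : y⁻¹ * c * y ∈ freeFactor K J) : y ∈ freeFactor K J := by
  rw [← inv_mem_iff]
  by_contra hy
  obtain ⟨a, ha, b, hb, k, hk, l, hl, w, hw⟩ := exists_eq_mul_neWord_mul hy
  obtain ⟨w', hw'⟩ := exists_neWord_conj (mul_mem (mul_mem hb hc) (inv_mem hb))
    (by rwa [Ne, conj_eq_one_iff]) hl w
  refine w'.prod_notMem_freeFactor hk ?_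
  have : w'.prod = a⁻¹ * (y⁻¹ * c * y) * a := by
    rw [hw', ← inv_inv y, hw]; group
  rw [this]
  exact mul_mem (mul_mem (inv_mem ha) h) ha

/-- Otherwise, after conjugation by an element of the factor, b is a reduced word that begins and
ends outside J, while a stays in the factor. Then the word W for a b begins in J and ends outside J.
A conjugate of an element of the factor has the form a₂ z' a₂⁻¹ with a₂ in the factor and z'
beginning and ending outside J. The first or last letters of W a₂ = a₂ z' do not match. -/
theorem mem_freeFactor_of_conj {J : Set ι} {a b c u : CoprodI K} (ha : a ∈ freeFactor K J)
    (ha1 : a ≠ 1) (hb1 : b ≠ 1) (hb : c⁻¹ * b * c ∈ freeFactor K J)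
    (hab : u⁻¹ * (a * b) * u ∈ freeFactor K J) : b ∈ freeFactor K J := by
  by_contra hbJ
  have hc : c ∉ freeFactor K J := fun hc => hbJ (by
    have := mul_mem (mul_mem hc hb) (inv_mem hc)
    convert this using 1
    group)
  obtain ⟨a₀, ha₀, a₁, ha₁, k, hk, l, hl, y, rfl⟩ := exists_eq_mul_neWord_mul hc
  obtain ⟨y', hy'⟩ := exists_neWord_conj (mul_mem (mul_mem ha₁ hb) (inv_mem ha₁))
    (by simpa [mul_assoc, mul_eq_one_iff_eq_inv] using hb1) hl y
  obtain ⟨i, hi, j, hj, x, hx⟩ := exists_neWord_of_mem_freeFactor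
    (mul_mem (mul_mem (inv_mem ha₀) ha) ha₀) (by
      have := conj_eq_one_iff (a := a₀⁻¹) (b := a)
      rw [inv_inv] at this
      rwa [Ne, this])
  obtain ⟨W, hW⟩ : ∃ W : NeWord K i k, W.prod = a₀⁻¹ * (a * b) * a₀ :=
    ⟨x.append (fun h : j = k => hk (h ▸ hj)) y', by
      rw [NeWord.append_prod, hx, hy']; group⟩
  have hv : a₀⁻¹ * u ∉ freeFactor K J := fun hv => by
    have h := mul_mem (mul_mem hv hab) (inv_mem hv)
    have h2 : W.inv.prod ∈ freeFactor K J := by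
      rw [NeWord.inv_prod, inv_mem_iff, hW]
      convert h using 1
      group
    exact W.inv.prod_notMem_freeFactor hk h2
  obtain ⟨a₂, ha₂, a₃, ha₃, k', hk', l', hl', z, hz⟩ := exists_eq_mul_neWord_mul hv
  have hd1 : u⁻¹ * (a * b) * u ≠ 1 := by
    intro h
    refine W.prod_ne_one ?_
    have : a * b = 1 := by
      have h' := conj_eq_one_iff (a := u⁻¹) (b := a * b)
      rw [inv_inv] at h'
      exact h'.1 h
    rw [hW, this]; group
  obtain ⟨z', hz'⟩ := exists_neWord_conj (mul_mem (mul_mem ha₃ hab) (inv_mem ha₃))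
    (by rwa [Ne, conj_eq_one_iff]) hl' z
  have hu : u = a₀ * (a₂ * z.prod * a₃) := by rw [← hz]; group
  have heq : W.prod * a₂ = a₂ * z'.prod := by
    rw [hW, hz']
    have : a₀⁻¹ * (a * b) * a₀ = (a₂ * z.prod * a₃) * (u⁻¹ * (a * b) * u) *
      (a₂ * z.prod * a₃)⁻¹ := by rw [← hz]; group
    rw [this]; group
  by_cases h1 : a₂ = 1
  · rw [h1, mul_one, one_mul] at heq
    exact hk' (NeWord.fst_eq_of_prod_eq heq ▸ hi)
  · obtain ⟨m, hm, n, hn, v, rfl⟩ := exists_neWord_of_mem_freeFactor ha₂ h1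
    have heq' : (W.append (fun h : k = m => hk (h ▸ hm)) v).prod =
        (v.append (fun h : n = k' => hk' (h ▸ hn)) z').prod := by
      rw [NeWord.append_prod, NeWord.append_prod, heq]
    exact hk' (NeWord.snd_eq_of_prod_eq heq' ▸ hn)

/-- Elementwise conjugacy into the free factor becomes simultaneous: once one nontrivial a ∈ Q has
been conjugated into the factor, `mem_freeFactor_of_conj` puts every other element there under the
same conjugation. The factor itself is countable. -/
theorem countable_of_forall_conj_mem_freeFactor [∀ i, Countable (K i)] {J : Set ι}
    (hJ : J.Countable) (Q : Subgroup (CoprodI K))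
    (h : ∀ x ∈ Q, ∃ c, c⁻¹ * x * c ∈ freeFactor K J) : Countable Q := by
  have := countable_freeFactor (K := K) hJ
  by_cases hQ : ∀ x ∈ Q, x = 1
  · have : Subsingleton Q := ⟨fun x y => Subtype.ext ((hQ _ x.2).trans (hQ _ y.2).symm)⟩
    infer_instance
  · push Not at hQ
    obtain ⟨a, haQ, ha1⟩ := hQ
    obtain ⟨c₀, hc₀⟩ := h a haQ
    have hconj : ∀ x : CoprodI K, c₀⁻¹ * x * c₀ = 1 ↔ x = 1 := fun x => by
      have := conj_eq_one_iff (a := c₀⁻¹) (b := x)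
      rwa [inv_inv] at this
    have key : ∀ b ∈ Q, c₀⁻¹ * b * c₀ ∈ freeFactor K J := by
      intro b hb
      by_cases hb1 : b = 1
      · simp [hb1, one_mem]
      · obtain ⟨c, hc⟩ := h b hb
        obtain ⟨u, hu⟩ := h _ (mul_mem haQ hb)
        refine mem_freeFactor_of_conj (c := c₀⁻¹ * c) (u := c₀⁻¹ * u) hc₀ ((hconj a).not.2 ha1)
          ((hconj b).not.2 hb1) ?_ ?_
        · convert hc using 1; group
        · convert hu using 1; group
    refine Function.Injective.countable (f := fun x : Q => (⟨_, key x x.2⟩ : freeFactor K J)) ?_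
    intro x y hxy
    have := congrArg Subtype.val hxy
    exact Subtype.ext (mul_left_cancel (mul_right_cancel this))

open Classical in
/-- The retraction that kills the factors with index outside `J`. -/
noncomputable def freeFactorRetraction (K : ι → Type*) [∀ i, Group (K i)] (J : Set ι) :
    CoprodI K →* CoprodI K :=
  lift fun i => if i ∈ J then of else 1

theorem freeFactorRetraction_of_mem {J : Set ι} {x : CoprodI K} (hx : x ∈ freeFactor K J) :
    freeFactorRetraction K J x = x := by
  have : freeFactor K J ≤ (freeFactorRetraction K J).eqLocus (MonoidHom.id _) :=
    freeFactor_le fun i hi x => by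
      change freeFactorRetraction K J (of x) = of x
      simp [freeFactorRetraction, hi]
  exact this hx

theorem freeFactorRetraction_mem {J J' J'' : Set ι} (h : J ∩ J' ⊆ J'') {x : CoprodI K}
    (hx : x ∈ freeFactor K J) : freeFactorRetraction K J' x ∈ freeFactor K J'' := by
  have : freeFactor K J ≤ (freeFactor K J'').comap (freeFactorRetraction K J') :=
    freeFactor_le fun i hi x => by
      rw [Subgroup.mem_comap, freeFactorRetraction, lift_of]
      split_ifs with h'
      · exact of_mem_freeFactor (h ⟨hi, h'⟩) x
      · exact one_mem _
  exact this hx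

/-- A homomorphism to a free product of countable groups has countable image on one of the
subgroups `Q n`, if the recursive equations `y n = (y (n + 1))⁻¹ * l n * y (n + 1)` with `l n` in
`Q n` are solvable. -/
theorem exists_countable_map [∀ i, Countable (K i)] {P : Type*} [Group P] (φ : P →* CoprodI K)
    (Q : ℕ → Subgroup P)
    (hQ : ∀ l : ℕ → P, (∀ n, l n ∈ Q n) → ∃ y : ℕ → P, ∀ n, y n = (y (n + 1))⁻¹ * l n * y (n + 1)) :
    ∃ n, Countable ((Q n).map φ) := by
  by_contra! hcon
  -- If every φ x were conjugate into the factor of the finite set J, the image of Q n would be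
  -- countable.
  have step : ∀ n (J : {J : Set ι // J.Finite}), ∃ x ∈ Q n,
      ∀ c, c⁻¹ * φ x * c ∉ freeFactor K J.1 := by
    intro n J
    by_contra! h
    refine not_countable_iff.2 (hcon n)
      (countable_of_forall_conj_mem_freeFactor J.2.countable _ ?_)
    rintro - ⟨x, hx, rfl⟩
    exact h x hx
  choose g hgQ hg using step
  choose supp hsupp hmem using fun x : CoprodI K => exists_finite_mem_freeFactor x
  -- J (n + 1) adds the support of the n-th chosen element, which itself is not conjugate into the
  -- factor of J n.
  let J : ℕ → {J : Set ι // J.Finite} := fun n => Nat.rec ⟨∅, Set.finite_empty⟩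
    (fun n J => ⟨J.1 ∪ supp (φ (g n J)), J.2.union (hsupp _)⟩) n
  have hJ : ∀ n, (J (n + 1)).1 = (J n).1 ∪ supp (φ (g n (J n))) := fun n => rfl
  have hmono : Monotone fun n => (J n).1 := monotone_nat_of_le_succ fun n => by
    change (J n).1 ⊆ (J (n + 1)).1
    rw [hJ]; exact Set.subset_union_left
  let Jinf : Set ι := ⋃ n, (J n).1
  let B : ℕ → Subgroup (CoprodI K) := fun m => freeFactor K ((J m).1 ∪ Jinfᶜ)
  obtain ⟨y, hy⟩ := hQ (fun n => g n (J n)) fun n => hgQ n _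
  have hlB : ∀ n, φ (g n (J n)) ∈ freeFactor K (J (n + 1)).1 := fun n =>
    freeFactor_mono (by rw [hJ]; exact Set.subset_union_right) (hmem _)
  have hl1 : ∀ n, φ (g n (J n)) ≠ 1 := fun n h => hg n (J n) 1 (by simp [h, one_mem])
  have hφ : ∀ n, φ (y n) = (φ (y (n + 1)))⁻¹ * φ (g n (J n)) * φ (y (n + 1)) := fun n => by
    conv_lhs => rw [hy n]
    simp
  -- The support of φ (y 0) is finite, so it meets the increasing union of the J n inside a single J
  -- m.
  obtain ⟨m, hm⟩ : ∃ m, φ (y 0) ∈ B m := by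
    have h1 : ∃ m, supp (φ (y 0)) ∩ Jinf ⊆ (J m).1 := by
      have hfin : (supp (φ (y 0)) ∩ Jinf).Finite := (hsupp _).inter_of_left _
      have := Directed.exists_mem_subset_of_finset_subset_biUnion (f := fun n => (J n).1)
        hmono.directed_le (s := hfin.toFinset) (by
          intro x hx
          exact (hfin.mem_toFinset.1 hx).2)
      obtain ⟨m, hm⟩ := this
      exact ⟨m, fun x hx => hm (by simpa using hx)⟩
    obtain ⟨m, hm⟩ := h1
    refine ⟨m, freeFactor_mono (fun x hx => ?_) (hmem _)⟩
    by_cases h : x ∈ Jinf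
    · exact Or.inl (hm ⟨hx, h⟩)
    · exact Or.inr h
  -- Malnormality passes membership from y i to y (i + 1) as long as the i-th coefficient lies in B
  -- m, that is for i < m.
  have hBm : ∀ i ≤ m, φ (y i) ∈ B m := by
    intro i
    induction i with
    | zero => exact fun _ => hm
    | succ i ih =>
      intro hi
      refine freeFactor_malnormal (freeFactor_mono ?_ (hlB i)) (hl1 i) (hφ i ▸ ih (by omega))
      exact (hmono hi).trans Set.subset_union_left
  have hfinal := hBm m le_rfl
  rw [hφ m] at hfinal
  -- Killing the factors outside the union of the J n maps B m into the factor of J m and fixes the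
  -- m-th coefficient, which thereby becomes conjugate into the factor of J m: a contradiction.
  have hsub : ((J m).1 ∪ Jinfᶜ) ∩ Jinf ⊆ (J m).1 := by
    rintro x ⟨hx | hx, hx'⟩
    · exact hx
    · exact absurd hx' hx
  have hr := freeFactorRetraction_mem hsub hfinal
  rw [map_mul, map_mul, map_inv, freeFactorRetraction_of_mem
    (freeFactor_mono (Set.subset_iUnion (fun n => (J n).1) (m + 1)) (hlB m))] at hr
  exact hg m (J m) _ hr

end Monoid.CoprodI

/-! ### Infinite nested products of small loops -/

section InfiniteLoops

variable {X : Type*} [MetricSpace X] {x : X}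

/-- The classes of the loops in the ball of radius `r`. -/
def loopSubgroup (x : X) (r : ℝ) (hr : 0 < r) : Subgroup (FundamentalGroup X x) where
  carrier := {g | ∃ γ : Path x x, (∀ t, dist (γ t) x < r) ∧ Path.Homotopic.Quotient.mk γ = g}
  one_mem' := ⟨Path.refl x, fun t => by simpa using hr, rfl⟩
  mul_mem' := by
    rintro _ _ ⟨γ, hγ, rfl⟩ ⟨γ', hγ', rfl⟩
    -- Multiplication in `FundamentalGroup` reverses the order of concatenation.
    refine ⟨γ'.trans γ, fun t => ?_, rfl⟩
    rw [Path.trans_apply]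
    split_ifs
    exacts [hγ' _, hγ _]
  inv_mem' := by
    rintro _ ⟨γ, hγ, rfl⟩
    exact ⟨γ.symm, fun t => hγ _, rfl⟩

/-- The truncations of the solution of `y n = y (n + 1) * l n * (y (n + 1))⁻¹`. -/
noncomputable def nestedConjugate (l : ℕ → Path x x) : ℕ → ℕ → Path x x
  | 0, _ => Path.refl x
  | M + 1, n =>
    (nestedConjugate l M (n + 1)).trans ((l n).trans (nestedConjugate l M (n + 1)).symm)

variable {l : ℕ → Path x x} {r : ℕ → ℝ}

theorem dist_nestedConjugate_lt (hr0 : ∀ n, 0 < r n) (hr : Antitone r)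
    (hl : ∀ n t, dist (l n t) x < r n) (M n : ℕ) (t : unitInterval) :
    dist (nestedConjugate l M n t) x < r n := by
  induction M generalizing n t with
  | zero => simpa [nestedConjugate] using hr0 n
  | succ M ih =>
    have h := fun t => (ih (n + 1) t).trans_le (hr n.le_succ)
    simp only [nestedConjugate, Path.trans_apply]
    split_ifs
    exacts [h _, hl _ _, h _]

/-- A longer truncation differs from a shorter one only where the innermost constant path is
replaced, and there it stays in a ball of radius r (n + M). -/
theorem nestedConjugate_eq_or (hr0 : ∀ n, 0 < r n) (hr : Antitone r)
    (hl : ∀ n t, dist (l n t) x < r n) (M M' n : ℕ) (hM : M ≤ M') (t : unitInterval) :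
    nestedConjugate l M' n t = nestedConjugate l M n t ∨
      (nestedConjugate l M n t = x ∧ dist (nestedConjugate l M' n t) x < r (n + M)) := by
  induction M generalizing n t M' with
  | zero => exact Or.inr ⟨rfl, dist_nestedConjugate_lt hr0 hr hl M' n t⟩
  | succ M ih =>
    obtain ⟨M', rfl⟩ : ∃ k, M' = k + 1 := ⟨M' - 1, by omega⟩
    have h := fun t => ih M' (n + 1) (by omega) t
    rw [show n + 1 + M = n + (M + 1) by ring] at h
    simp only [nestedConjugate, Path.trans_apply]
    split_ifs
    exacts [h _, Or.inl rfl, h _]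

/-- At a fixed time the truncations either all equal x or become constant once one of them leaves x.
No completeness is needed, and the error bound is uniform in t. -/
theorem exists_nestedConjugate_limit (hr0 : ∀ n, 0 < r n) (hr : Antitone r)
    (hl : ∀ n t, dist (l n t) x < r n) (n : ℕ) (t : unitInterval) :
    ∃ z, Tendsto (fun M => nestedConjugate l M n t) atTop (𝓝 z) ∧
      ∀ M, dist z (nestedConjugate l M n t) ≤ r (n + M) := by
  have key := fun M M' hM => nestedConjugate_eq_or hr0 hr hl M M' n hM t
  by_cases h : ∀ M, nestedConjugate l M n t = x
  · exact ⟨x, by simp [h], fun M => by simpa [h] using (hr0 _).le⟩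
  · push Not at h
    obtain ⟨M₀, hM₀⟩ := h
    have hconst : ∀ M, M₀ ≤ M → nestedConjugate l M n t = nestedConjugate l M₀ n t := fun M hM =>
      (key M₀ M hM).resolve_right fun h => hM₀ h.1
    refine ⟨nestedConjugate l M₀ n t, tendsto_atTop_of_eventually_const hconst, fun M => ?_⟩
    rcases key M (max M M₀) (le_max_left _ _) with h | ⟨h, h'⟩
    · rw [← hconst _ (le_max_right M M₀), h, dist_self]
      exact (hr0 _).le
    · rw [h, ← hconst _ (le_max_right M M₀)]
      exact h'.le

/-- An infinite system of equations in the fundamental group is solved by infinite products. -/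
theorem exists_nestedConjugate (hr0 : ∀ n, 0 < r n) (hr : Antitone r)
    (hr1 : Tendsto r atTop (𝓝 0)) (hl : ∀ n t, dist (l n t) x < r n) :
    ∃ y : ℕ → Path x x, ∀ n, y n = (y (n + 1)).trans ((l n).trans (y (n + 1)).symm) := by
  choose Z hZ hZr using exists_nestedConjugate_limit hr0 hr hl
  have hcont : ∀ n, Continuous (Z n) := fun n => by
    refine TendstoUniformly.continuous (F := fun M => nestedConjugate l M n) (p := atTop) ?_
      (Frequently.of_forall fun M => (nestedConjugate l M n).continuous)
    rw [Metric.tendstoUniformly_iff]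
    intro ε hε
    have := (hr1.comp (tendsto_add_atTop_nat n)).eventually (gt_mem_nhds hε)
    filter_upwards [this] with M hM t
    refine (hZr n t M).trans_lt ?_
    rw [add_comm]; exact hM
  let y : ℕ → Path x x := fun n =>
    { toFun := Z n
      continuous_toFun := hcont n
      source' := tendsto_nhds_unique (hZ n 0) (by simp)
      target' := tendsto_nhds_unique (hZ n 1) (by simp) }
  refine ⟨y, fun n => Path.ext (funext fun t => ?_)⟩
  refine tendsto_nhds_unique ((hZ n t).comp (tendsto_add_atTop_nat 1)) ?_
  have h := fun t => hZ (n + 1) t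
  simp only [Function.comp_def, nestedConjugate, Path.trans_apply]
  split_ifs
  exacts [h _, tendsto_const_nhds, h _]

/-- A homomorphism from a fundamental group to a free product of countable groups has countable
image on the small loops at some scale. -/
theorem exists_countable_map_loopSubgroup {ι : Type*} {K : ι → Type*} [∀ i, Group (K i)]
    [∀ i, Countable (K i)] (φ : FundamentalGroup X x →* Monoid.CoprodI K) :
    ∃ r, ∃ hr : 0 < r, Countable ((loopSubgroup x r hr).map φ) := by
  have h0 : ∀ n : ℕ, 0 < 1 / ((n : ℝ) + 1) := fun n => Nat.one_div_pos_of_nat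
  obtain ⟨n, hn⟩ := Monoid.CoprodI.exists_countable_map φ (fun n => loopSubgroup x _ (h0 n)) (by
    intro g hg
    choose l hl hlg using hg
    obtain ⟨y, hy⟩ := exists_nestedConjugate h0 (fun a b h => Nat.one_div_le_one_div h)
      tendsto_one_div_add_atTop_nhds_zero_nat hl
    refine ⟨fun n => Path.Homotopic.Quotient.mk (y n), fun n => ?_⟩
    rw [← hlg]
    -- Because of the reversed multiplication, conjugation by y (n + 1) on the left as a path is
    -- conjugation by its inverse in the group.
    exact congrArg Path.Homotopic.Quotient.mk (hy n))
  exact ⟨_, _, hn⟩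

end InfiniteLoops

/-! ### Free products of free and countable groups -/

section FreeProducts

open Monoid

/-- A free group is a free product of infinite cyclic groups; a countable group is a free product
with one factor. -/
theorem exists_mulEquiv_coprodI_countable {G : Type} [Group G]
    (h : IsFreeGroup G ∨ Countable G) :
    ∃ (B : Type) (K : B → Type) (_ : ∀ b, Group (K b)),
      (∀ b, Countable (K b)) ∧ Nonempty (G ≃* CoprodI K) := by
  rcases h with h | h
  · have : Countable (FreeGroup Unit) := FreeGroup.freeGroupUnitEquivInt.countable_iff.2 inferInstance
    exact ⟨_, _, inferInstance, fun _ => this,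
      ⟨(IsFreeGroup.mulEquiv G).symm.trans freeGroupEquivCoprodI⟩⟩
  · refine ⟨Unit, fun _ => G, inferInstance, fun _ => h, ⟨MulEquiv.symm ?_⟩⟩
    refine MonoidHom.toMulEquiv (CoprodI.lift fun _ => MonoidHom.id G)
      (CoprodI.of (M := fun _ : Unit => G) (i := ())) ?_ ?_
    · exact CoprodI.ext_hom _ _ fun i => by ext; simp
    · ext; simp

theorem exists_injective_coprodI_countable.{u} {ι : Type u} {G : ι → Type} [∀ i, Group (G i)]
    (h : ∀ i, IsFreeGroup (G i) ∨ Countable (G i)) :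
    ∃ (B : Type u) (K : B → Type) (_ : ∀ b, Group (K b)) (f : CoprodI G →* CoprodI K),
      (∀ b, Countable (K b)) ∧ Function.Injective f := by
  choose B K hK hc e using fun i => exists_mulEquiv_coprodI_countable (h i)
  have e := fun i => (e i).some
  let of' : ∀ i, CoprodI (K i) →* CoprodI fun x : Σ i, B i => K x.1 x.2 := fun i =>
    CoprodI.lift fun b => CoprodI.of (M := fun x : Σ i, B i => K x.1 x.2) (i := ⟨i, b⟩)
  let f : CoprodI G →* CoprodI fun x : Σ i, B i => K x.1 x.2 :=
    CoprodI.lift fun i => (of' i).comp (e i).toMonoidHom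
  let f' : CoprodI (fun x : Σ i, B i => K x.1 x.2) →* CoprodI G :=
    CoprodI.lift fun x => (CoprodI.of.comp (e x.1).symm.toMonoidHom).comp CoprodI.of
  refine ⟨Σ i, B i, fun x => K x.1 x.2, inferInstance, f, fun x => hc x.1 x.2,
    Function.LeftInverse.injective (g := f') ?_⟩
  have h1 : ∀ i, f'.comp (of' i) = CoprodI.of.comp (e i).symm.toMonoidHom := fun i =>
    CoprodI.ext_hom _ _ fun b => by ext; simp [f', of']
  have h2 : f'.comp f = MonoidHom.id _ := CoprodI.ext_hom _ _ fun i => by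
    ext y
    have := DFunLike.congr_fun (h1 i) (e i y)
    simp only [MonoidHom.comp_apply] at this
    simp [f, this]
  exact fun y => DFunLike.congr_fun h2 y

/-- If all scales of small loops at `x` give uncountable subgroups of the fundamental group, then
every free product decomposition has an uncountable factor that is not free. -/
theorem IsInternalFreeProduct.exists_not_isFreeGroup_uncountable {X : Type} [MetricSpace X] {x : X}
    (hx : ∀ r, ∀ hr : 0 < r, Uncountable (loopSubgroup x r hr)) {ι : Type*}
    {H : ι → Subgroup (FundamentalGroup X x)} (hH : IsInternalFreeProduct H) :
    ∃ i, ¬ IsFreeGroup (H i) ∧ Uncountable (H i) := by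
  by_contra! hcon
  obtain ⟨B, K, _, f, hK, hf⟩ := exists_injective_coprodI_countable (G := fun i => H i)
    fun i => or_iff_not_imp_left.2 fun h => hcon i h
  obtain ⟨r, hr, hc⟩ := exists_countable_map_loopSubgroup (x := x)
    (f.comp (MulEquiv.ofBijective _ hH).symm.toMonoidHom)
  have := hx r hr
  have hinj : Function.Injective (f.comp (MulEquiv.ofBijective _ hH).symm.toMonoidHom) :=
    hf.comp (MulEquiv.ofBijective _ hH).symm.injective
  exact not_countable (α := loopSubgroup x r hr)
    ((Subgroup.equivMapOfInjective (loopSubgroup x r hr) _ hinj).toEquiv.countable_iff.2 hc)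

end FreeProducts

/-! ### Monodromy of a principal bundle with two charts -/

section TwoChartCovering

open Bundle

variable {X F : Type*} [TopologicalSpace X] [TopologicalSpace F]

/-- A local constant section. -/
def FiberBundleCore.localSection {ι : Type*} (Z : FiberBundleCore ι X F) (i : ι) (v : F) (x : X) :
    Z.TotalSpace :=
  ⟨x, Z.coordChange i (Z.indexAt x) x v⟩

theorem FiberBundleCore.continuousOn_localSection {ι : Type*} (Z : FiberBundleCore ι X F) (i : ι)
    (v : F) : ContinuousOn (Z.localSection i v) (Z.baseSet i) := by
  have h := (Z.localTriv i).continuousOn_invFun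
  refine (h.comp (f := fun x => (x, v)) (s := Z.baseSet i) (by fun_prop) ?_).congr ?_
  · intro x hx
    exact (Z.mem_localTriv_target i (x, v)).2 hx
  · intro x hx
    rfl

theorem FiberBundleCore.localSection_coordChange {ι : Type*} (Z : FiberBundleCore ι X F) {i j : ι}
    (v : F) {x : X} (hi : x ∈ Z.baseSet i) (hj : x ∈ Z.baseSet j) :
    Z.localSection j (Z.coordChange i j x v) x = Z.localSection i v x := by
  unfold FiberBundleCore.localSection
  rw [Z.coordChange_comp i j _ x ⟨⟨hi, hj⟩, Z.mem_baseSet_at x⟩]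

variable [DiscreteTopology F]

theorem FiberBundleCore.isCoveringMap {ι : Type*} (Z : FiberBundleCore ι X F) :
    IsCoveringMap (π F Z.Fiber) :=
  FiberBundle.isCoveringMap

/-- Inside one chart the constant section along γ is the lift of γ. -/
theorem FiberBundleCore.monodromy_localSection {ι : Type*} (Z : FiberBundleCore ι X F) (i : ι)
    (v : F) {x y : X} (γ : Path x y) (hγ : ∀ t, γ t ∈ Z.baseSet i) :
    Z.isCoveringMap.monodromy (Path.Homotopic.Quotient.mk γ) ⟨Z.localSection i v x, rfl⟩ =
      ⟨Z.localSection i v y, rfl⟩ := by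
  refine Subtype.ext ?_
  have hc : Continuous fun t => Z.localSection i v (γ t) :=
    (Z.continuousOn_localSection i v).comp_continuous γ.continuous hγ
  have h := (Z.isCoveringMap.eq_liftPath_iff' (γ := γ) (e := Z.localSection i v x)
    (Γ := ⟨_, hc⟩) (by simp; rfl)).2 ⟨rfl, by simp⟩
  have h1 := congrArg (fun f : C(unitInterval, Z.TotalSpace) => f 1) h
  simp only [ContinuousMap.coe_mk, Path.target] at h1
  exact h1.symm

theorem FiberBundleCore.exists_monodromy_eq {ι : Type*} (Z : FiberBundleCore ι X F) {x y : X}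
    (γ : Path.Homotopic.Quotient x y) (v : F) :
    ∃ w : F, Z.isCoveringMap.monodromy γ ⟨⟨x, v⟩, rfl⟩ = ⟨⟨y, w⟩, rfl⟩ := by
  obtain ⟨⟨y', w⟩, hw⟩ := Z.isCoveringMap.monodromy γ ⟨⟨x, v⟩, rfl⟩
  obtain rfl : y' = y := hw
  exact ⟨w, rfl⟩

variable [Group F] {A B : Set X} {σ : X → F}

open Classical in
/-- The principal bundle over `A ∪ B` with discrete fibre and transition function `σ`. -/
noncomputable def twoChartCore (hA : IsOpen A) (hB : IsOpen B) (hAB : A ∪ B = Set.univ)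
    (hσ : ∀ x ∈ A ∩ B, ∀ᶠ y in 𝓝 x, σ y = σ x) : FiberBundleCore Bool X F where
  baseSet i := if i then A else B
  isOpen_baseSet i := by cases i <;> assumption
  indexAt x := decide (x ∈ A)
  mem_baseSet_at x := by
    by_cases h : x ∈ A
    · simp [h]
    · have : x ∈ A ∪ B := hAB ▸ Set.mem_univ x
      simpa [h] using this
  coordChange i j x v := if i then (if j then v else σ x * v) else (if j then (σ x)⁻¹ * v else v)
  coordChange_self i x _ v := by cases i <;> simp
  continuousOn_coordChange i j := by
    have h1 : ContinuousOn (fun p : X × F => σ p.1) ((A ∩ B) ×ˢ Set.univ) := by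
      rintro ⟨x, v⟩ ⟨hx, -⟩
      refine ContinuousAt.continuousWithinAt ?_
      have h2 : Tendsto σ (𝓝 x) (𝓝 (σ x)) := tendsto_nhds_of_eventually_eq (hσ x hx)
      exact h2.comp continuous_fst.continuousAt
    have h3 : ContinuousOn (fun p : X × F => σ p.1 * p.2) ((A ∩ B) ×ˢ Set.univ) :=
      h1.mul continuousOn_snd
    have h4 : ContinuousOn (fun p : X × F => (σ p.1)⁻¹ * p.2) ((A ∩ B) ×ˢ Set.univ) :=
      h1.inv.mul continuousOn_snd
    cases i <;> cases j
    · simpa using continuousOn_snd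
    · simpa [Set.inter_comm] using h4
    · simpa using h3
    · simpa using continuousOn_snd
  coordChange_comp i j k x _ v := by
    cases i <;> cases j <;> cases k <;> simp

/-- Right translation by g commutes with the transition functions, so it is a global continuous map
of the bundle and carries lifts to lifts. -/
theorem FiberBundleCore.monodromy_mul_right {ι : Type*} (Z : FiberBundleCore ι X F)
    (hZ : ∀ i j x v g, Z.coordChange i j x (v * g) = Z.coordChange i j x v * g)
    {x y : X} (γ : Path.Homotopic.Quotient x y) (v g w : F)
    (h : Z.isCoveringMap.monodromy γ ⟨⟨x, v⟩, rfl⟩ = ⟨⟨y, w⟩, rfl⟩) :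
    Z.isCoveringMap.monodromy γ ⟨⟨x, (v * g : F)⟩, rfl⟩ = ⟨⟨y, (w * g : F)⟩, rfl⟩ := by
  let R : Z.TotalSpace → Z.TotalSpace := fun e => ⟨e.1, ((show F from e.2) * g : F)⟩
  have hR : Continuous R := by
    rw [continuous_iff_continuousAt]
    intro e
    rw [FiberBundle.continuousAt_totalSpace]
    refine ⟨Z.continuous_proj.continuousAt, ?_⟩
    have h1 : ContinuousAt (fun e' : Z.TotalSpace => (trivializationAt F Z.Fiber e.proj e').2) e :=
      ((FiberBundle.continuousAt_totalSpace F (id : Z.TotalSpace → Z.TotalSpace)).1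
        continuousAt_id).2
    refine (h1.mul (continuousAt_const (y := g))).congr (Eventually.of_forall fun e' => ?_)
    exact (hZ _ _ _ _ _).symm
  obtain ⟨γ⟩ := γ
  refine Subtype.ext ?_
  have h0 := congrArg Subtype.val h
  have hl := Z.isCoveringMap.liftPath_lifts γ (⟨x, v⟩ : Z.TotalSpace) (by simp)
  have hs := Z.isCoveringMap.liftPath_zero γ (⟨x, v⟩ : Z.TotalSpace) (by simp)
  have h := (Z.isCoveringMap.eq_liftPath_iff' (γ := γ) (e := (⟨x, (v * g : F)⟩ : Z.TotalSpace))
    (Γ := (⟨R, hR⟩ : C(Z.TotalSpace, Z.TotalSpace)).comp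
      (Z.isCoveringMap.liftPath γ (⟨x, v⟩ : Z.TotalSpace) (by simp))) (by simp)).2
    ⟨hl, by rw [ContinuousMap.comp_apply, hs]; rfl⟩
  have h1 := congrArg (fun f : C(unitInterval, Z.TotalSpace) => f 1) h
  refine h1.symm.trans ?_
  change R (Z.isCoveringMap.liftPath γ (⟨x, v⟩ : Z.TotalSpace) _ 1) = _
  rw [show Z.isCoveringMap.liftPath γ (⟨x, v⟩ : Z.TotalSpace) _ 1 = ⟨y, w⟩ from h0]

/-- The monodromy homomorphism of a principal bundle with discrete fibre. -/
theorem FiberBundleCore.exists_monodromyHom {ι : Type*} (Z : FiberBundleCore ι X F)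
    (hZ : ∀ i j x v g, Z.coordChange i j x (v * g) = Z.coordChange i j x v * g) (x : X) :
    ∃ Φ : FundamentalGroup X x →* F, ∀ γ : Path.Homotopic.Quotient x x,
      Z.isCoveringMap.monodromy γ ⟨⟨x, (1 : F)⟩, rfl⟩ = ⟨⟨x, Φ γ⟩, rfl⟩ := by
  choose φ hφ using fun γ : Path.Homotopic.Quotient x x => Z.exists_monodromy_eq γ 1
  have inj : ∀ v w : F, (⟨⟨x, v⟩, rfl⟩ : π F Z.Fiber ⁻¹' {x}) = ⟨⟨x, w⟩, rfl⟩ → v = w := by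
    intro v w h
    exact TotalSpace.mk_injective x (congrArg Subtype.val h)
  refine ⟨MonoidHom.mk' φ fun γ γ' => inj _ _ ?_, hφ⟩
  -- The product γ * γ' is the path γ' followed by γ; together with right equivariance this makes φ
  -- a homomorphism, not an antihomomorphism.
  have h1 := hφ (γ'.trans γ)
  rw [IsCoveringMap.monodromy_trans_apply, hφ γ'] at h1
  have h2 := Z.monodromy_mul_right hZ γ 1 (φ γ') (φ γ) (hφ γ)
  rw [one_mul] at h2
  exact h1.symm.trans h2

/-- If `X` is covered by two open sets `A` and `B`, then a locally constant function on `A ∩ B`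
with values in a group `F` induces a homomorphism from the fundamental group to `F`. -/
theorem exists_fundamentalGroup_hom {F : Type*} [Group F] {σ : X → F}
    (hA : IsOpen A) (hB : IsOpen B) (hAB : A ∪ B = Set.univ)
    (hσ : ∀ x ∈ A ∩ B, ∀ᶠ y in 𝓝 x, σ y = σ x) {x : X} (hx : x ∈ A) :
    ∃ Φ : FundamentalGroup X x →* F, ∀ (u w : X) (γ₁ : Path x u) (γ₂ : Path u w) (γ₃ : Path w x),
      (∀ t, γ₁ t ∈ A) → (∀ t, γ₂ t ∈ B) → (∀ t, γ₃ t ∈ A) →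
      Φ (Path.Homotopic.Quotient.mk (γ₁.trans (γ₂.trans γ₃))) = (σ w)⁻¹ * σ u := by
  let _ : TopologicalSpace F := ⊥
  have : DiscreteTopology F := ⟨rfl⟩
  let Z := twoChartCore hA hB hAB hσ
  obtain ⟨Φ, hΦ⟩ := Z.exists_monodromyHom (by
    intro i j x v g
    cases i <;> cases j <;> simp [Z, twoChartCore, mul_assoc]) x
  refine ⟨Φ, fun u w γ₁ γ₂ γ₃ h₁ h₂ h₃ => ?_⟩
  have hsec : ∀ v : F, Z.localSection true v x = ⟨x, v⟩ := by
    intro v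
    simp [FiberBundleCore.localSection, Z, twoChartCore, hx]
  have hu : Z.localSection false (σ u) u = Z.localSection true (1 : F) u := by
    rw [← Z.localSection_coordChange (i := true) (j := false)]
    · simp [Z, twoChartCore]
    · exact (γ₁.target ▸ h₁ 1 : u ∈ A)
    · exact (γ₂.source ▸ h₂ 0 : u ∈ B)
  have hw : Z.localSection false (σ u) w = Z.localSection true ((σ w)⁻¹ * σ u) w := by
    rw [← Z.localSection_coordChange (i := false) (j := true)]
    · simp [Z, twoChartCore]
    · exact (γ₂.target ▸ h₂ 1 : w ∈ B)
    · exact (γ₃.source ▸ h₃ 0 : w ∈ A)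
  have m₁ := Z.monodromy_localSection true (1 : F) γ₁ h₁
  have m₂ := Z.monodromy_localSection false (σ u) γ₂ h₂
  have m₃ := Z.monodromy_localSection true ((σ w)⁻¹ * σ u) γ₃
    h₃
  have m := hΦ (Path.Homotopic.Quotient.mk (γ₁.trans (γ₂.trans γ₃)))
  simp only [hu, hw, hsec] at m₁ m₂ m₃
  rw [Path.Homotopic.Quotient.mk_trans, Path.Homotopic.Quotient.mk_trans,
    IsCoveringMap.monodromy_trans_apply, IsCoveringMap.monodromy_trans_apply, m₁, m₂, m₃] at m
  exact (TotalSpace.mk_injective x (congrArg Subtype.val m)).symm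

end TwoChartCovering

/-! ### Word metrics -/

namespace FiniteGeneratingSet

variable {G : Type} [Group G] (S : FiniteGeneratingSet G)

/-- The word metric on the group. -/
noncomputable def wordDist (g h : G) : ℝ := ((SimpleGraph.mulCayley S.carrier).dist g h : ℝ)

theorem wordDist_nonneg (g h : G) : 0 ≤ S.wordDist g h := Nat.cast_nonneg _

theorem wordDist_comm (g h : G) : S.wordDist g h = S.wordDist h g :=
  dist_comm (α := S.WordMetricSpace) g h

theorem wordDist_self (g : G) : S.wordDist g g = 0 := dist_self (α := S.WordMetricSpace) g

theorem wordDist_triangle (g h k : G) : S.wordDist g k ≤ S.wordDist g h + S.wordDist h k :=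
  dist_triangle (α := S.WordMetricSpace) g h k

theorem abs_sub_le_mul_wordDist {F : G → ℝ} {K : ℝ}
    (hF : ∀ s ∈ S.carrier, ∀ g, |F (g * s) - F g| ≤ K) (x y : G) :
    |F x - F y| ≤ K * S.wordDist x y := by
  obtain ⟨w, hw⟩ := S.mulCayley_connected.exists_walk_length_eq_dist x y
  rw [wordDist, ← hw]
  clear hw
  induction w with
  | nil => simp
  | @cons u v w h p ih =>
    have h1 : |F u - F v| ≤ K := by
      obtain ⟨-, s, hs, h | h⟩ := (SimpleGraph.mulCayley_adj' _ _ _).1 h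
      · rw [← h, abs_sub_comm]; exact hF s hs u
      · rw [h]; exact hF s hs v
    have h2 := abs_sub_le (F u) (F v) (F w)
    rw [SimpleGraph.Walk.length_cons]
    push_cast
    linarith

/-- The hypothesis concerns all s ∈ G, so it can be checked by induction on words in a and t
although S is arbitrary. Finiteness of S supplies the common constant. -/
theorem exists_abs_sub_le_mul_wordDist {F : G → ℝ} (hF : ∀ s, ∃ c, ∀ g, |F (g * s) - F g| ≤ c) :
    ∃ K, 0 ≤ K ∧ ∀ x y, |F x - F y| ≤ K * S.wordDist x y := by
  choose c hc using hF
  obtain ⟨K, hK⟩ := (S.finite.image c).bddAbove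
  refine ⟨max K 0, le_max_right _ _, S.abs_sub_le_mul_wordDist fun s hs g => ?_⟩
  exact (hc s g).trans ((hK ⟨s, hs, rfl⟩).trans (le_max_left _ _))

theorem wordDist_mul_left_le (g x y : G) : S.wordDist (g * x) (g * y) ≤ S.wordDist x y := by
  have := S.abs_sub_le_mul_wordDist (F := fun u => S.wordDist (g * x) (g * u)) (K := 1) (by
    intro s hs u
    have h1 : S.wordDist (g * u) (g * u * s) ≤ 1 := by
      by_cases h : g * u = g * u * s
      · rw [← h, wordDist_self]; exact zero_le_one
      · have h2 : (SimpleGraph.mulCayley S.carrier).Adj (g * u) (g * u * s) :=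
          (SimpleGraph.mulCayley_adj' _ _ _).2 ⟨h, s, hs, Or.inl rfl⟩
        rw [wordDist, SimpleGraph.dist_eq_one_iff_adj.2 h2, Nat.cast_one]
    rw [← mul_assoc, abs_le]
    have h2 := S.wordDist_triangle (g * x) (g * u) (g * u * s)
    have h3 := S.wordDist_triangle (g * x) (g * u * s) (g * u)
    rw [S.wordDist_comm (g * u * s)] at h3
    constructor <;> linarith) y x
  rw [wordDist_self, sub_zero, abs_of_nonneg (S.wordDist_nonneg _ _), one_mul,
    S.wordDist_comm y x] at this
  exact this

theorem wordDist_mul_left (g x y : G) : S.wordDist (g * x) (g * y) = S.wordDist x y := by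
  refine le_antisymm (S.wordDist_mul_left_le g x y) ?_
  simpa using S.wordDist_mul_left_le g⁻¹ (g * x) (g * y)

theorem wordDist_mul_right (g u : G) : S.wordDist g (g * u) = S.wordDist 1 u := by
  simpa using S.wordDist_mul_left g 1 u

theorem wordDist_one_mul_le (u v : G) :
    S.wordDist 1 (u * v) ≤ S.wordDist 1 u + S.wordDist 1 v := by
  have := S.wordDist_triangle 1 u (u * v)
  rwa [wordDist_mul_right] at this

theorem wordDist_one_inv (u : G) : S.wordDist 1 u⁻¹ = S.wordDist 1 u := by
  have := S.wordDist_mul_left u 1 u⁻¹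
  rw [mul_inv_cancel, mul_one, wordDist_comm] at this
  exact this.symm

theorem wordDist_one_zpow_le (u : G) (n : ℤ) : S.wordDist 1 (u ^ n) ≤ |n| * S.wordDist 1 u := by
  have h : ∀ n : ℕ, S.wordDist 1 (u ^ n) ≤ n * S.wordDist 1 u := by
    intro n
    induction n with
    | zero => simp [wordDist_self]
    | succ n ih =>
      rw [pow_succ]
      refine (S.wordDist_one_mul_le _ _).trans ?_
      push_cast
      linarith
  obtain ⟨m, rfl | rfl⟩ := n.eq_nat_or_neg
  · simpa using h m
  · rw [zpow_neg, wordDist_one_inv]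
    simpa using h m

theorem wordDist_le_mul_of_step {W : ℕ → G} {K : ℝ} (hW : ∀ i, S.wordDist (W i) (W (i + 1)) ≤ K)
    (i j : ℕ) : S.wordDist (W i) (W j) ≤ K * |(i : ℝ) - j| := by
  have h : ∀ i k : ℕ, S.wordDist (W i) (W (i + k)) ≤ K * k := by
    intro i k
    induction k with
    | zero => simp [wordDist_self]
    | succ k ih =>
      have := S.wordDist_triangle (W i) (W (i + k)) (W (i + (k + 1)))
      have := hW (i + k)
      rw [add_assoc] at this
      push_cast
      linarith
  rcases le_total i j with hij | hij
  · obtain ⟨k, rfl⟩ := Nat.exists_eq_add_of_le hij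
    simpa using h i k
  · obtain ⟨k, rfl⟩ := Nat.exists_eq_add_of_le hij
    rw [wordDist_comm]
    simpa using h j k

end FiniteGeneratingSet

/-! ### Points, functions and curves in the asymptotic cone -/

section Cone

variable {G : Type} [Group G] {S : FiniteGeneratingSet G} {ω : Ultrafilter ℕ}
  {d : ScalingSequence ω} {e : ℕ → S.WordMetricSpace}

theorem ScalingSequence.tendsto_const_div (d : ScalingSequence ω) (c : ℝ) :
    Tendsto (fun k => c / d.toFun k) (ω : Filter ℕ) (𝓝 0) :=
  d.tendsto_atTop.const_div_atTop c

namespace ConeSequence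

/-- The terms of a sequence of points, as elements of the group. -/
def term (y : ConeSequence S.WordMetricSpace ω d e) (k : ℕ) : G := y.1 k

theorem tendsto_wordDist (y z : ConeSequence S.WordMetricSpace ω d e) :
    Tendsto (fun k => S.wordDist (y.term k) (z.term k) / d.toFun k) (ω : Filter ℕ)
      (𝓝 (dist y z)) :=
  y.tendsto_limDist z

/-- The additive error b vanishes after division by d, which tends to infinity. -/
theorem dist_le {y z : ConeSequence S.WordMetricSpace ω d e} {c b : ℝ}
    (h : ∀ᶠ k in (ω : Filter ℕ), S.wordDist (y.term k) (z.term k) ≤ c * d.toFun k + b) :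
    dist y z ≤ c := by
  have h1 : Tendsto (fun k => c + b / d.toFun k) (ω : Filter ℕ) (𝓝 c) := by
    simpa using (d.tendsto_const_div b).const_add c
  refine le_of_tendsto_of_tendsto (tendsto_wordDist y z) h1 ?_
  filter_upwards [h] with k hk
  rwa [div_le_iff₀ (d.pos k), add_mul, div_mul_cancel₀ _ (d.pos k).ne']

theorem mk_eq_mk {y z : ConeSequence S.WordMetricSpace ω d e} {b : ℝ}
    (h : ∀ᶠ k in (ω : Filter ℕ), S.wordDist (y.term k) (z.term k) ≤ b) :
    SeparationQuotient.mk y = SeparationQuotient.mk z := by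
  rw [SeparationQuotient.mk_eq_mk, Metric.inseparable_iff]
  exact le_antisymm (dist_le (b := b) (by simpa using h)) dist_nonneg

/-- The sequence of the translates of the terms of `x` by a sequence of linear growth. -/
def translate (x : ConeSequence S.WordMetricSpace ω d e) (u : ℕ → G)
    (hu : ∃ M, ∀ᶠ k in (ω : Filter ℕ), S.wordDist 1 (u k) ≤ M * d.toFun k) :
    ConeSequence S.WordMetricSpace ω d e :=
  ⟨fun k => x.term k * u k, by
    obtain ⟨M, hM⟩ := hu
    obtain ⟨N, hN⟩ := x.2
    refine ⟨M + N, ?_⟩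
    filter_upwards [hN, hM] with k hk h3
    have hd := d.pos k
    rw [div_lt_iff₀ hd] at hk ⊢
    have h1 : S.wordDist (x.term k * u k) (e k) ≤
        S.wordDist (x.term k * u k) (x.term k) + S.wordDist (x.term k) (e k) :=
      S.wordDist_triangle _ _ _
    have h2 : S.wordDist (x.term k) (e k) < N * d.toFun k := hk
    rw [S.wordDist_comm, S.wordDist_mul_right] at h1
    change S.wordDist (x.term k * u k) (e k) < _
    linarith⟩

theorem translate_term (x : ConeSequence S.WordMetricSpace ω d e) (u : ℕ → G)
    (hu : ∃ M, ∀ᶠ k in (ω : Filter ℕ), S.wordDist 1 (u k) ≤ M * d.toFun k) (k : ℕ) :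
    (x.translate u hu).term k = x.term k * u k := rfl

/-- The rescaled limit of a Lipschitz function on the group, based at the sequence `x`. -/
noncomputable def rescaledLimit (F : G → ℝ) (x y : ConeSequence S.WordMetricSpace ω d e) : ℝ :=
  limUnder (ω : Filter ℕ) fun k => F ((x.term k)⁻¹ * y.term k) / d.toFun k

variable {F : G → ℝ} {K : ℝ}

theorem tendsto_rescaledLimit (hF : ∀ g h, |F g - F h| ≤ K * S.wordDist g h) (h1 : F 1 = 0)
    (x y : ConeSequence S.WordMetricSpace ω d e) :
    Tendsto (fun k => F ((x.term k)⁻¹ * y.term k) / d.toFun k) (ω : Filter ℕ)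
      (𝓝 (rescaledLimit F x y)) := by
  have hle : ∀ k, |F ((x.term k)⁻¹ * y.term k) / d.toFun k| ≤
      K * (S.wordDist (x.term k) (y.term k) / d.toFun k) := fun k => by
    have := hF ((x.term k)⁻¹ * y.term k) 1
    rw [h1, sub_zero, S.wordDist_comm, ← S.wordDist_mul_left (x.term k), mul_one,
      mul_inv_cancel_left] at this
    rw [abs_div, abs_of_pos (d.pos k), ← mul_div_assoc]
    exact div_le_div_of_nonneg_right this (d.pos k).le
  have hb : ∀ᶠ k in (ω : Filter ℕ), K * (S.wordDist (x.term k) (y.term k) / d.toFun k) <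
      K * dist x y + 1 :=
    ((tendsto_wordDist x y).const_mul K).eventually (gt_mem_nhds (lt_add_one _))
  have hmem : ∀ᶠ k in (ω : Filter ℕ), F ((x.term k)⁻¹ * y.term k) / d.toFun k ∈
      Set.Icc (-(K * dist x y + 1)) (K * dist x y + 1) := by
    filter_upwards [hb] with k hk
    exact abs_le.1 ((hle k).trans hk.le)
  obtain ⟨l, -, hl⟩ := (isCompact_Icc (a := -(K * dist x y + 1))
    (b := K * dist x y + 1)).ultrafilter_le_nhds
    (ω.map fun k => F ((x.term k)⁻¹ * y.term k) / d.toFun k) (le_principal_iff.2 hmem)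
  exact tendsto_nhds_limUnder ⟨l, hl⟩

theorem abs_rescaledLimit_sub_le (hF : ∀ g h, |F g - F h| ≤ K * S.wordDist g h) (h1 : F 1 = 0)
    (x y z : ConeSequence S.WordMetricSpace ω d e) :
    |rescaledLimit F x y - rescaledLimit F x z| ≤ K * dist y z := by
  refine le_of_tendsto_of_tendsto' ((tendsto_rescaledLimit hF h1 x y).sub
    (tendsto_rescaledLimit hF h1 x z)).abs ((tendsto_wordDist y z).const_mul K) fun k => ?_
  rw [← sub_div, abs_div, abs_of_pos (d.pos k), ← mul_div_assoc]
  refine div_le_div_of_nonneg_right ((hF _ _).trans ?_) (d.pos k).le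
  rw [S.wordDist_mul_left]

/-- `rescaledLimit` on the asymptotic cone. -/
theorem exists_continuous_rescaledLimit (hF : ∀ g h, |F g - F h| ≤ K * S.wordDist g h)
    (h1 : F 1 = 0) (x : ConeSequence S.WordMetricSpace ω d e) :
    ∃ r : AsymptoticCone S.WordMetricSpace ω d e → ℝ, Continuous r ∧
      ∀ y, r (SeparationQuotient.mk y) = rescaledLimit F x y := by
  have hc : Continuous (rescaledLimit F x) := by
    have : LipschitzWith K.toNNReal (rescaledLimit F x) := LipschitzWith.of_dist_le' fun y z => by
      rw [Real.dist_eq]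
      exact abs_rescaledLimit_sub_le hF h1 x y z
    exact this.continuous
  exact ⟨SeparationQuotient.lift _ fun y z h => (h.map hc).eq,
    SeparationQuotient.continuous_lift hc, fun y => rfl⟩

end ConeSequence

/-- A sequence of discrete paths with bounded steps yields a curve in the asymptotic cone. -/
noncomputable def coneCurveSequence (x : ConeSequence S.WordMetricSpace ω d e) (W : ℕ → ℕ → G)
    {K : ℝ} (hK : 0 ≤ K) (hW0 : ∃ M, ∀ᶠ k in (ω : Filter ℕ), S.wordDist 1 (W k 0) ≤ M * d.toFun k)
    (hW : ∀ k i, S.wordDist (W k i) (W k (i + 1)) ≤ K) (s : ℝ) :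
    ConeSequence S.WordMetricSpace ω d e :=
  x.translate (fun k => W k ⌊s * d.toFun k⌋₊) <| by
    obtain ⟨M, hM⟩ := hW0
    refine ⟨M + K * |s|, ?_⟩
    filter_upwards [hM] with k h5
    have h1 := S.wordDist_triangle 1 (W k 0) (W k ⌊s * d.toFun k⌋₊)
    have h2 := S.wordDist_le_mul_of_step (hW k) 0 ⌊s * d.toFun k⌋₊
    have h3 : (⌊s * d.toFun k⌋₊ : ℝ) ≤ |s| * d.toFun k := by
      refine (Nat.cast_le.2 (Nat.floor_mono
        (mul_le_mul_of_nonneg_right (le_abs_self s) (d.pos k).le))).trans ?_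
      exact Nat.floor_le (mul_nonneg (abs_nonneg _) (d.pos k).le)
    have h4 := mul_le_mul_of_nonneg_left h3 hK
    simp only [Nat.cast_zero, zero_sub, abs_neg, Nat.abs_cast] at h2
    linarith

theorem dist_coneCurveSequence_le (x : ConeSequence S.WordMetricSpace ω d e) (W : ℕ → ℕ → G)
    {K : ℝ} (hK : 0 ≤ K) (hW0 : ∃ M, ∀ᶠ k in (ω : Filter ℕ), S.wordDist 1 (W k 0) ≤ M * d.toFun k)
    (hW : ∀ k i, S.wordDist (W k i) (W k (i + 1)) ≤ K) (s s' : ℝ) :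
    dist (coneCurveSequence x W hK hW0 hW s) (coneCurveSequence x W hK hW0 hW s') ≤
      K * |s - s'| := by
  refine ConeSequence.dist_le (b := K) (Eventually.of_forall fun k => ?_)
  have hd := d.pos k
  rw [coneCurveSequence, coneCurveSequence, ConeSequence.translate_term,
    ConeSequence.translate_term, S.wordDist_mul_left]
  refine (S.wordDist_le_mul_of_step (hW k) _ _).trans ?_
  have key : ∀ a b : ℝ, ((⌊a⌋₊ : ℝ) - ⌊b⌋₊) ≤ |a - b| + 1 := by
    intro a b
    rcases le_total 0 a with ha | ha
    · have h1 := Nat.floor_le ha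
      have h2 := Nat.lt_floor_add_one b
      have h3 := le_abs_self (a - b)
      linarith
    · rw [Nat.floor_of_nonpos ha]
      have h2 : (0 : ℝ) ≤ ⌊b⌋₊ := Nat.cast_nonneg _
      have h3 := abs_nonneg (a - b)
      push_cast
      linarith
  have h : |(⌊s * d.toFun k⌋₊ : ℝ) - ⌊s' * d.toFun k⌋₊| ≤ |s - s'| * d.toFun k + 1 := by
    have h1 := key (s * d.toFun k) (s' * d.toFun k)
    have h2 := key (s' * d.toFun k) (s * d.toFun k)
    rw [abs_sub_comm (s' * d.toFun k)] at h2
    rw [← sub_mul, abs_mul, abs_of_pos hd] at h1 h2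
    rw [abs_le]
    constructor <;> linarith
  have := mul_le_mul_of_nonneg_left h hK
  linarith

end Cone

/-- The restriction of a curve to an interval, traversed from `s` to `s'`. -/
def curvePath {X : Type*} [TopologicalSpace X] {c : ℝ → X} (hc : Continuous c) (s s' : ℝ) :
    Path (c s) (c s') where
  toFun t := c (s + t * (s' - s))
  continuous_toFun := by fun_prop
  source' := by simp
  target' := by simp

theorem exists_curvePath_eq {X : Type*} [TopologicalSpace X] {c : ℝ → X} (hc : Continuous c)
    (s s' : ℝ) (t : unitInterval) : ∃ u ∈ Set.Icc (min s s') (max s s'),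
      curvePath hc s s' t = c u := by
  refine ⟨_, ?_, rfl⟩
  obtain ⟨t, h0, h1⟩ := t
  rcases le_total s s' with h | h
  · simp only [min_eq_left h, max_eq_right h, Set.mem_Icc]
    constructor <;> nlinarith
  · simp only [min_eq_right h, max_eq_left h, Set.mem_Icc]
    constructor <;> nlinarith

/-! ### Coordinates, base-q/p expansions and short paths to powers of a -/

namespace BaumslagSolitar

/-- The height, the depth in a branch of the Bass–Serre tree, and the horizontal position of the
elements of a Baumslag–Solitar group. -/
structure Coordinates {G : Type} [Group G] (p q : ℤ) (a t : G) where
  height : G →* Multiplicative ℤ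
  depth : G → ℤ
  pos : G → ℝ
  height_a : height a = 1
  height_t : height t = Multiplicative.ofAdd 1
  depth_one : depth 1 = 0
  depth_nonneg : ∀ g, 0 ≤ depth g
  depth_mul_a : ∀ g, depth (g * a) = depth g
  abs_depth_mul_t : ∀ g, |depth (g * t) - depth g| ≤ 1
  neg_depth_le_height : ∀ g, 0 < depth g → -depth g ≤ (height g).toAdd
  depth_branch : ∀ (N : ℤ) (i : ℕ), q ∣ N → depth (a ^ N * t⁻¹ ^ i) = i
  depth_other_branch : ∀ (N : ℤ) (i : ℕ), q ∣ N → depth (a ^ (N + 1) * t⁻¹ ^ i) = 0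
  pos_a : pos a = 1
  pos_t : pos t = 0
  pos_mul : ∀ g u, pos (g * u) = pos g + ((p : ℝ) / q) ^ (height g).toAdd * pos u

theorem exists_coordinates {G : Type} [Group G] {p q : ℤ} {a t : G}
    (hB : IsBaumslagSolitar p q a t) (hp : p ≠ 0) (hpq : |p| < |q|) :
    Nonempty (Coordinates p q a t) := by
  have hp1 := Int.one_le_abs hp
  have hq : q ≠ 0 := by rintro rfl; simp at hpq; omega
  obtain ⟨h, ρ, ha, ht, h1, h2, h3, h4, h5, h6, h7⟩ := exists_branchDepth hB hp hq
  obtain ⟨pos, h8, h9, h10⟩ := exists_position hB hp hq ha ht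
  exact ⟨⟨h, ρ, pos, ha, ht, h1, h2, h3, h4, h5, h6, h7 (by omega), h8, h9, h10⟩⟩

namespace Coordinates

variable {G : Type} [Group G] {p q : ℤ} {a t : G} (D : Coordinates p q a t)
  (S : FiniteGeneratingSet G)

theorem pos_one : D.pos 1 = 0 := by
  have := D.pos_mul 1 1
  simpa using this

theorem pos_mul_a (g : G) : D.pos (g * a) = D.pos g + ((p : ℝ) / q) ^ (D.height g).toAdd := by
  rw [D.pos_mul, D.pos_a, mul_one]

theorem pos_mul_t (g : G) : D.pos (g * t) = D.pos g := by
  rw [D.pos_mul, D.pos_t, mul_zero, add_zero]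

theorem pos_mul_t_inv (g : G) : D.pos (g * t⁻¹) = D.pos g := by
  have := D.pos_mul_t (g * t⁻¹)
  rw [inv_mul_cancel_right] at this
  exact this.symm

theorem pos_mul_a_zpow (g : G) (n : ℤ) :
    D.pos (g * a ^ n) = D.pos g + ((p : ℝ) / q) ^ (D.height g).toAdd * n := by
  induction n with
  | zero => simp
  | succ n ih =>
    rw [zpow_add_one, ← mul_assoc, D.pos_mul_a, ih, map_mul, map_zpow, D.height_a, one_zpow,
      mul_one]
    push_cast; ring
  | pred n ih =>
    have := D.pos_mul_a (g * a ^ (-(n : ℤ) - 1))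
    rw [mul_assoc, ← zpow_add_one, sub_add_cancel, ih, map_mul, map_zpow, D.height_a, one_zpow,
      mul_one] at this
    push_cast at this ⊢
    linarith

theorem pos_mul_t_inv_pow (g : G) (i : ℕ) : D.pos (g * t⁻¹ ^ i) = D.pos g := by
  induction i with
  | zero => simp
  | succ i ih => rw [pow_succ, ← mul_assoc, D.pos_mul_t_inv, ih]

theorem depth_mul_a_zpow (g : G) (n : ℤ) : D.depth (g * a ^ n) = D.depth g := by
  induction n with
  | zero => simp
  | succ n ih => rw [zpow_add_one, ← mul_assoc, D.depth_mul_a, ih]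
  | pred n ih =>
    have := D.depth_mul_a (g * a ^ (-(n : ℤ) - 1))
    rw [mul_assoc, ← zpow_add_one, sub_add_cancel, ih] at this
    exact this.symm

theorem exists_depth_lipschitz (hB : IsBaumslagSolitar p q a t) :
    ∃ K, 0 ≤ K ∧ ∀ g h, |(D.depth g : ℝ) - D.depth h| ≤ K * S.wordDist g h := by
  refine S.exists_abs_sub_le_mul_wordDist (F := fun g => (D.depth g : ℝ)) fun s => ?_
  induction s using hB.induction with
  | ha => exact ⟨0, fun g => by simp [D.depth_mul_a]⟩
  | ht => exact ⟨1, fun g => by exact_mod_cast D.abs_depth_mul_t g⟩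
  | h1 => exact ⟨0, fun g => by simp⟩
  | hmul x y hx hy =>
    obtain ⟨c, hc⟩ := hx
    obtain ⟨c', hc'⟩ := hy
    refine ⟨c' + c, fun g => ?_⟩
    rw [← mul_assoc]
    exact (abs_sub_le _ (D.depth (g * x) : ℝ) _).trans (add_le_add (hc' _) (hc _))
  | hinv x hx =>
    obtain ⟨c, hc⟩ := hx
    refine ⟨c, fun g => ?_⟩
    have := hc (g * x⁻¹)
    rwa [inv_mul_cancel_right, abs_sub_comm] at this

/-- The function N = 1 + |p/q|^height + |pos| is submultiplicative, so log N is Lipschitz for the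
word metric; the factor 2 is N 1. -/
theorem exists_pos_le_exp (hp : p ≠ 0) (hq : q ≠ 0) :
    ∃ K, 0 ≤ K ∧ ∀ u, |D.pos u| ≤ 2 * Real.exp (K * S.wordDist 1 u) := by
  have hpq : |(p : ℝ) / q| ≠ 0 := by
    have hp' : (p : ℝ) ≠ 0 := by exact_mod_cast hp
    have hq' : (q : ℝ) ≠ 0 := by exact_mod_cast hq
    simp [hp', hq']
  let N : G → ℝ := fun u => 1 + |(p : ℝ) / q| ^ (D.height u).toAdd + |D.pos u|
  have hz : ∀ u, 0 ≤ |(p : ℝ) / q| ^ (D.height u).toAdd := fun u => zpow_nonneg (abs_nonneg _) _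
  have hN1 : ∀ u, 1 ≤ N u := fun u => by
    have := hz u
    have := abs_nonneg (D.pos u)
    simp only [N]; linarith
  have hN0 : ∀ u, 0 < N u := fun u => one_pos.trans_le (hN1 u)
  have hmul : ∀ u v, N (u * v) ≤ N u * N v := fun u v => by
    have h1 : |D.pos (u * v)| ≤
        |D.pos u| + |(p : ℝ) / q| ^ (D.height u).toAdd * |D.pos v| := by
      rw [D.pos_mul, ← abs_zpow, ← abs_mul]
      exact abs_add_le _ _
    have h2 : |(p : ℝ) / q| ^ (D.height (u * v)).toAdd =
        |(p : ℝ) / q| ^ (D.height u).toAdd * |(p : ℝ) / q| ^ (D.height v).toAdd := by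
      rw [map_mul, toAdd_mul, zpow_add₀ hpq]
    have h3 := hz u
    have h4 := hz v
    have h5 := abs_nonneg (D.pos u)
    have h6 := abs_nonneg (D.pos v)
    simp only [N, h2]
    nlinarith [mul_nonneg h5 h4, mul_nonneg h5 h6]
  have hlog : ∀ u v, Real.log (N (u * v)) ≤ Real.log (N u) + Real.log (N v) := fun u v => by
    rw [← Real.log_mul (hN0 u).ne' (hN0 v).ne']
    exact Real.log_le_log (hN0 _) (hmul u v)
  obtain ⟨K, hK0, hK⟩ := S.exists_abs_sub_le_mul_wordDist (F := fun u => Real.log (N u)) fun s =>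
    ⟨max (Real.log (N s)) (Real.log (N s⁻¹)), fun g => by
      have h1 := hlog g s
      have h2 := hlog (g * s) s⁻¹
      rw [mul_inv_cancel_right] at h2
      have h3 := le_max_left (Real.log (N s)) (Real.log (N s⁻¹))
      have h4 := le_max_right (Real.log (N s)) (Real.log (N s⁻¹))
      rw [abs_le]
      constructor <;> linarith⟩
  refine ⟨K, hK0, fun u => ?_⟩
  have h1 : N 1 = 2 := by simp [N, D.pos_one]; norm_num
  have h2 := (le_abs_self _).trans (hK u 1)
  rw [h1, S.wordDist_comm] at h2
  have h3 : Real.log (N u) ≤ Real.log 2 + K * S.wordDist 1 u := by linarith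
  rw [Real.log_le_iff_le_exp (hN0 u), Real.exp_add, Real.exp_log two_pos] at h3
  refine le_trans ?_ h3
  have := hz u
  simp only [N]; linarith

end Coordinates

/-- The remainders of the base-`q / p` expansion of `N`. -/
def expansionRem (p q N : ℤ) : ℕ → ℤ
  | 0 => N
  | i + 1 => p * (expansionRem p q N i / q)

/-- The initial words of the base-`q / p` expansion of `a ^ N`. -/
def expansionPrefix {G : Type} [Group G] (p q : ℤ) (a t : G) (N : ℤ) : ℕ → G
  | 0 => 1
  | i + 1 => expansionPrefix p q a t N i * (a ^ (expansionRem p q N i % q) * t⁻¹)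

variable {G : Type} [Group G] {p q : ℤ} {a t : G}

/-- Dividing the remainder by q with quotient k and digit r gives a^(r + qk) t⁻¹ = a^r t⁻¹ a^(pk):
the digit joins the prefix and pk is the next remainder. -/
theorem expansionPrefix_mul (hB : IsBaumslagSolitar p q a t) (N : ℤ) (i : ℕ) :
    expansionPrefix p q a t N i * a ^ expansionRem p q N i = a ^ N * t⁻¹ ^ i := by
  induction i with
  | zero => simp [expansionPrefix, expansionRem]
  | succ i ih =>
    have h1 : t⁻¹ * a ^ (p * (expansionRem p q N i / q)) =
        a ^ (q * (expansionRem p q N i / q)) * t⁻¹ := by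
      rw [zpow_mul, zpow_mul, ← hB.rel]
      have : t⁻¹ * a ^ p * t = MulAut.conj t⁻¹ (a ^ p) := by simp
      rw [this, ← map_zpow]
      simp
    rw [expansionPrefix, expansionRem, mul_assoc, mul_assoc, h1, ← mul_assoc (a ^ _), ← zpow_add,
      Int.emod_add_mul_ediv, ← mul_assoc, ih, pow_succ, mul_assoc]

theorem expansionPrefix_eq (hB : IsBaumslagSolitar p q a t) (N : ℤ) (i : ℕ) :
    expansionPrefix p q a t N i = a ^ N * t⁻¹ ^ i * a ^ (-expansionRem p q N i) := by
  rw [← expansionPrefix_mul hB, mul_assoc, ← zpow_add]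
  simp

/-- Each step contracts the remainder by |p/q| up to an error |p|; the last term sums the geometric
series. After m steps a number of order |q/p|^m has a bounded remainder. -/
theorem abs_expansionRem_le (hp : p ≠ 0) (hpq : |p| < |q|) (N : ℤ) (i : ℕ) :
    |(expansionRem p q N i : ℝ)| ≤
      |(p : ℝ) / q| ^ i * |(N : ℝ)| + |(p : ℝ)| / (1 - |(p : ℝ) / q|) := by
  have hq0 : (0 : ℝ) < |(q : ℝ)| := by
    have : (0 : ℤ) < |q| := (abs_nonneg p).trans_lt hpq
    exact_mod_cast this
  have hlt : |(p : ℝ) / q| < 1 := by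
    rw [abs_div, div_lt_one hq0]
    exact_mod_cast hpq
  have h1 : 0 < 1 - |(p : ℝ) / q| := by linarith
  induction i with
  | zero =>
    have : 0 ≤ |(p : ℝ)| / (1 - |(p : ℝ) / q|) := by positivity
    simp only [expansionRem, pow_zero, one_mul]; linarith
  | succ i ih =>
    have hq : q ≠ 0 := by rintro rfl; simp at hq0
    have h2 : |((expansionRem p q N i / q : ℤ) : ℝ)| ≤
        |(expansionRem p q N i : ℝ)| / |(q : ℝ)| + 1 := by
      have h3 := Int.mul_ediv_add_emod (expansionRem p q N i) q
      have h4 : |expansionRem p q N i % q| < |q| := by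
        rw [abs_of_nonneg (Int.emod_nonneg _ hq)]; exact Int.emod_lt_abs _ hq
      have h5 : |q| * |expansionRem p q N i / q| ≤ |expansionRem p q N i| + |q| := by
        rw [← abs_mul]
        have : q * (expansionRem p q N i / q) =
          expansionRem p q N i - expansionRem p q N i % q := by omega
        rw [this]
        exact (abs_sub _ _).trans (by omega)
      rw [div_add_one hq0.ne', le_div_iff₀ hq0, mul_comm]
      exact_mod_cast h5
    rw [expansionRem, Int.cast_mul, abs_mul]
    refine (mul_le_mul_of_nonneg_left h2 (abs_nonneg _)).trans ?_
    have h6 : |(p : ℝ)| * (|(expansionRem p q N i : ℝ)| / |(q : ℝ)| + 1) =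
        |(p : ℝ) / q| * |(expansionRem p q N i : ℝ)| + |(p : ℝ)| := by
      rw [abs_div]; ring
    rw [h6]
    refine (add_le_add_left (mul_le_mul_of_nonneg_left ih (abs_nonneg _)) _).trans (le_of_eq ?_)
    rw [pow_succ]
    field_simp
    ring

theorem height_expansionPrefix (D : Coordinates p q a t) (N : ℤ) (i : ℕ) :
    (D.height (expansionPrefix p q a t N i)).toAdd = -i := by
  induction i with
  | zero => simp [expansionPrefix]
  | succ i ih =>
    rw [expansionPrefix, map_mul, toAdd_mul, ih, map_mul, map_zpow, D.height_a, map_inv, D.height_t]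
    simp; ring

/-- The digit at height -i is smaller than |q| in absolute value and moves the position by its
(q/p)^i-fold, so the last term of a geometric sum dominates. -/
theorem abs_pos_expansionPrefix_le (D : Coordinates p q a t) (hp : p ≠ 0) (hpq : |p| < |q|) (N : ℤ)
    (i : ℕ) : |D.pos (expansionPrefix p q a t N i)| ≤
      |(q : ℝ)| / (|(q : ℝ) / p| - 1) * |(q : ℝ) / p| ^ i := by
  have hp0 : (0 : ℝ) < |(p : ℝ)| := by
    have : (0 : ℤ) < |p| := abs_pos.2 hp
    exact_mod_cast this
  have hlt : 1 < |(q : ℝ) / p| := by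
    rw [abs_div, one_lt_div hp0]
    exact_mod_cast hpq
  have h1 : 0 < |(q : ℝ) / p| - 1 := by linarith
  induction i with
  | zero =>
    rw [expansionPrefix, D.pos_one, abs_zero]
    positivity
  | succ i ih =>
    have hq : q ≠ 0 := by rintro rfl; simp at hpq; exact absurd hpq (not_lt.2 (abs_nonneg p))
    have h4 : |((expansionRem p q N i % q : ℤ) : ℝ)| ≤ |(q : ℝ)| := by
      have : |expansionRem p q N i % q| ≤ |q| := by
        rw [abs_of_nonneg (Int.emod_nonneg _ hq)]; exact (Int.emod_lt_abs _ hq).le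
      exact_mod_cast this
    rw [expansionPrefix, ← mul_assoc, D.pos_mul_t_inv, D.pos_mul_a_zpow, height_expansionPrefix]
    have h5 : |((p : ℝ) / q) ^ (-(i : ℤ)) * ((expansionRem p q N i % q : ℤ) : ℝ)| ≤
        |(q : ℝ) / p| ^ i * |(q : ℝ)| := by
      rw [abs_mul, zpow_neg, zpow_natCast, ← inv_pow, inv_div, abs_pow]
      exact mul_le_mul_of_nonneg_left h4 (by positivity)
    refine ((abs_add_le _ _).trans (add_le_add ih h5)).trans (le_of_eq ?_)
    rw [pow_succ]
    field_simp
    ring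

/-- Discrete paths of logarithmic length from `1` to `a ^ N` in a branch of the Bass–Serre tree. -/
theorem exists_branch_path (hB : IsBaumslagSolitar p q a t) (D : Coordinates p q a t)
    (S : FiniteGeneratingSet G) (hp : p ≠ 0) (hpq : |p| < |q|) (C : ℝ) :
    ∃ K, 0 ≤ K ∧ ∀ (N : ℤ) (m : ℕ), q ∣ N → |(N : ℝ)| ≤ C * |(q : ℝ) / p| ^ m →
      ∃ W : ℕ → G, W 0 = 1 ∧ (∀ i, m < i → W i = a ^ N * t⁻¹ ^ (2 * m - i)) ∧
        (∀ i ≤ m, D.depth (W i) = i) ∧ (∀ i, m < i → D.depth (W i) = (2 * m - i : ℕ)) ∧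
        (∀ i, D.depth (a * W i) = 0) ∧ (∀ i, S.wordDist (W i) (W (i + 1)) ≤ K) ∧
        (∀ i ≤ m, |D.pos (W i)| ≤ K * |(q : ℝ) / p| ^ i) ∧ ∀ i, m < i → D.pos (W i) = N := by
  have hq : q ≠ 0 := by rintro rfl; simp at hpq; exact absurd hpq (not_lt.2 (abs_nonneg p))
  have hp' : (p : ℝ) ≠ 0 := by exact_mod_cast hp
  have hq' : (q : ℝ) ≠ 0 := by exact_mod_cast hq
  set Λ : ℝ := |(q : ℝ) / p| with hΛ
  have hΛ0 : 0 < Λ := abs_pos.2 (div_ne_zero hq' hp')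
  have hΛinv : |(p : ℝ) / q| = Λ⁻¹ := by rw [hΛ, ← abs_inv, inv_div]
  set K₁ : ℝ := |(p : ℝ)| / (1 - |(p : ℝ) / q|)
  set K₂ : ℝ := |(q : ℝ)| / (Λ - 1)
  set la := S.wordDist 1 a
  set lt := S.wordDist 1 t
  have hla : 0 ≤ la := S.wordDist_nonneg _ _
  have hlt : 0 ≤ lt := S.wordDist_nonneg _ _
  -- The three entries bound an expansion step, the jump at i = m, and the position of a prefix.
  set K : ℝ := max (max (|(q : ℝ)| * la + lt) ((C + K₁) * la + lt)) K₂
  have hKq : |(q : ℝ)| * la + lt ≤ K := (le_max_left _ _).trans (le_max_left _ _)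
  have hKC : (C + K₁) * la + lt ≤ K := (le_max_right _ _).trans (le_max_left _ _)
  have hKt : lt ≤ K := le_trans (by have := mul_nonneg (abs_nonneg (q : ℝ)) hla; linarith) hKq
  have hK0 : 0 ≤ K := hlt.trans hKt
  refine ⟨K, hK0, fun N m hN hNm => ?_⟩
  let W : ℕ → G := fun i =>
    if i ≤ m then expansionPrefix p q a t N i else a ^ N * t⁻¹ ^ (2 * m - i)
  have hW₁ : ∀ i ≤ m, W i = expansionPrefix p q a t N i := fun i hi => if_pos hi
  have hW₂ : ∀ i, m < i → W i = a ^ N * t⁻¹ ^ (2 * m - i) := fun i hi => if_neg (not_le.2 hi)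
  have hstep : ∀ i, ∃ u, W (i + 1) = W i * u ∧ S.wordDist 1 u ≤ K := by
    intro i
    rcases lt_trichotomy i m with hi | rfl | hi
    · refine ⟨a ^ (expansionRem p q N i % q) * t⁻¹, ?_, ?_⟩
      · rw [hW₁ i hi.le, hW₁ (i + 1) hi, expansionPrefix]
      · refine (S.wordDist_one_mul_le _ _).trans (le_trans ?_ hKq)
        rw [S.wordDist_one_inv]
        refine add_le_add_left ((S.wordDist_one_zpow_le _ _).trans
          (mul_le_mul_of_nonneg_right ?_ hla)) _
        have : |expansionRem p q N i % q| ≤ |q| := by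
          rw [abs_of_nonneg (Int.emod_nonneg _ hq)]; exact (Int.emod_lt_abs _ hq).le
        exact_mod_cast this
    -- The jump from the m-th prefix to a^N t^(-(m-1)) multiplies by a^rem t with a bounded
    -- remainder.
    · have hrem : |(expansionRem p q N i : ℝ)| ≤ C + K₁ := by
        have h : _ ≤ |(p : ℝ) / q| ^ i * |(N : ℝ)| + K₁ := abs_expansionRem_le hp hpq N i
        refine h.trans ?_
        rw [hΛinv, inv_pow, inv_mul_eq_div]
        exact add_le_add_left ((div_le_iff₀ (pow_pos hΛ0 i)).2 hNm) _
      have hrem' : S.wordDist 1 (a ^ expansionRem p q N i) ≤ (C + K₁) * la :=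
        (S.wordDist_one_zpow_le _ _).trans
          (mul_le_mul_of_nonneg_right (by exact_mod_cast hrem) hla)
      rw [hW₂ _ i.lt_succ_self, hW₁ i le_rfl]
      rcases Nat.eq_zero_or_pos i with rfl | hi
      -- For m = 0 the path goes from 1 to a^N at once, without a letter t.
      · exact ⟨a ^ expansionRem p q N 0, by simp [expansionPrefix, expansionRem],
          (hrem'.trans (by linarith)).trans hKC⟩
      · refine ⟨a ^ expansionRem p q N i * t, ?_, ?_⟩
        · rw [← mul_assoc, expansionPrefix_mul hB, mul_assoc]
          congr 1
          obtain ⟨j, rfl⟩ : ∃ j, i = j + 1 := ⟨i - 1, by omega⟩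
          rw [show 2 * (j + 1) - (j + 1 + 1) = j by omega, pow_succ, inv_mul_cancel_right]
        · exact (S.wordDist_one_mul_le _ _).trans ((add_le_add_left hrem' _).trans hKC)
    · rw [hW₂ i hi, hW₂ (i + 1) (by omega)]
      rcases Nat.lt_or_ge i (2 * m) with h | h
      · refine ⟨t, ?_, hKt⟩
        obtain ⟨j, hj⟩ : ∃ j, 2 * m - i = j + 1 := ⟨2 * m - i - 1, by omega⟩
        rw [hj, show 2 * m - (i + 1) = j by omega, pow_succ, mul_assoc, inv_mul_cancel_right]
      -- From i = 2m on, truncated subtraction keeps the path at a^N.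
      · refine ⟨1, ?_, by rw [S.wordDist_self]; exact hK0⟩
        rw [show 2 * m - (i + 1) = 0 by omega, show 2 * m - i = 0 by omega, mul_one]
  refine ⟨W, by rw [hW₁ 0 m.zero_le]; rfl, hW₂, fun i hi => ?_, fun i hi => ?_, fun i => ?_,
    fun i => ?_, fun i hi => ?_, fun i hi => ?_⟩
  · rw [hW₁ i hi, expansionPrefix_eq hB, D.depth_mul_a_zpow, D.depth_branch N i hN]
  · rw [hW₂ i hi, D.depth_branch N _ hN]
  · rcases le_or_gt i m with hi | hi
    -- Up to a power of a on the right, a W i is a^(N+1) t^(-i), which lies in another branch since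
    -- q does not divide N + 1.
    · rw [hW₁ i hi, expansionPrefix_eq hB, ← mul_assoc, ← mul_assoc, D.depth_mul_a_zpow,
        ← zpow_one_add, add_comm, D.depth_other_branch N i hN]
    · rw [hW₂ i hi, ← mul_assoc, ← zpow_one_add, add_comm, D.depth_other_branch N _ hN]
  · obtain ⟨u, hu, huK⟩ := hstep i
    rwa [hu, S.wordDist_mul_right]
  · rw [hW₁ i hi]
    exact (abs_pos_expansionPrefix_le D hp hpq N i).trans
      (mul_le_mul_of_nonneg_right (le_max_right _ _) (pow_pos hΛ0 i).le)
  · rw [hW₂ i hi, D.pos_mul_t_inv_pow]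
    have := D.pos_mul_a_zpow 1 N
    simpa [D.pos_one] using this

end BaumslagSolitar

/-! ### Position classes and their local constancy -/

section Labels

open BaumslagSolitar

variable {G : Type} [Group G] {S : FiniteGeneratingSet G} {ω : Ultrafilter ℕ}
  {d : ScalingSequence ω} {e : ℕ → S.WordMetricSpace}

theorem ScalingSequence.eventually_mul_exp_le (d : ScalingSequence ω) (B : ℝ) {α β : ℝ}
    (h : α < β) : ∀ᶠ k in (ω : Filter ℕ),
      B * Real.exp (α * d.toFun k) ≤ Real.exp (β * d.toFun k) := by
  have h1 : Tendsto (fun k => Real.exp ((β - α) * d.toFun k)) (ω : Filter ℕ) atTop :=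
    Real.tendsto_exp_atTop.comp (d.tendsto_atTop.const_mul_atTop (sub_pos.2 h))
  filter_upwards [h1.eventually_ge_atTop B] with k hk
  refine (mul_le_mul_of_nonneg_right hk (Real.exp_pos _).le).trans (le_of_eq ?_)
  rw [← Real.exp_add]; ring_nf

/-- Two sequences of points are equivalent if the distances of their horizontal positions grow at a
rate below `T`. -/
def positionSetoid (pos : G → ℝ) (x : ConeSequence S.WordMetricSpace ω d e) (T : ℝ) :
    Setoid (ConeSequence S.WordMetricSpace ω d e) where
  r y z := ∃ η < T, ∀ᶠ k in (ω : Filter ℕ),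
    |pos ((x.term k)⁻¹ * y.term k) - pos ((x.term k)⁻¹ * z.term k)| ≤ Real.exp (η * d.toFun k)
  iseqv :=
    { refl := fun y => ⟨T - 1, by linarith, by simp [Real.exp_nonneg]⟩
      symm := fun {y z} ⟨η, hη, h⟩ => ⟨η, hη, by simpa only [abs_sub_comm] using h⟩
      trans := fun {y z w} ⟨η, hη, h⟩ ⟨η', hη', h'⟩ => by
        -- The strict inequality η < T leaves room to absorb the factor 2 of the triangle inequality
        -- in a larger rate.
        refine ⟨(max η η' + T) / 2, by have := max_lt hη hη'; linarith, ?_⟩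
        have hlt : max η η' < (max η η' + T) / 2 := by have := max_lt hη hη'; linarith
        filter_upwards [h, h', d.eventually_mul_exp_le 2 hlt] with k h₁ h₂ h₃
        have hd := (d.pos k).le
        have h₄ := Real.exp_le_exp.2 (mul_le_mul_of_nonneg_right (le_max_left η η') hd)
        have h₅ := Real.exp_le_exp.2 (mul_le_mul_of_nonneg_right (le_max_right η η') hd)
        refine (abs_sub_le _ _ _).trans ((add_le_add h₁ h₂).trans ?_)
        linarith }

/-- In a branch of the Bass–Serre tree, the classes at small depth are open. -/
theorem exists_positionSetoid_of_dist_lt {p q : ℤ} {a t : G} (D : Coordinates p q a t)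
    (hB : IsBaumslagSolitar p q a t) (hp : p ≠ 0) (hpq : |p| < |q|)
    (x y : ConeSequence S.WordMetricSpace ω d e) {T : ℝ}
    (h0 : 0 < ConeSequence.rescaledLimit (fun g => (D.depth g : ℝ)) x y)
    (hT : Real.log |(q : ℝ) / p| * ConeSequence.rescaledLimit (fun g => (D.depth g : ℝ)) x y < T) :
    ∃ μ > 0, ∀ z, dist y z < μ → positionSetoid D.pos x T y z := by
  have hq : q ≠ 0 := by rintro rfl; simp at hpq; exact absurd hpq (not_lt.2 (abs_nonneg p))
  have hp0 : (0 : ℝ) < |(p : ℝ)| := by exact_mod_cast abs_pos.2 hp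
  have hΛ : 1 < |(q : ℝ) / p| := by
    rw [abs_div, one_lt_div hp0]
    exact_mod_cast hpq
  have hΛ0 : 0 < |(q : ℝ) / p| := one_pos.trans hΛ
  set c := Real.log |(q : ℝ) / p|
  have hc : 0 < c := Real.log_pos hΛ
  obtain ⟨Kρ, -, hKρ⟩ := D.exists_depth_lipschitz S hB
  obtain ⟨Kp, hKp0, hKp⟩ := D.exists_pos_le_exp S hp hq
  set r := ConeSequence.rescaledLimit (fun g => (D.depth g : ℝ)) x y with hr
  -- The gap pays three times: for the fluctuation g / c of the rescaled depth, for the step from y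
  -- to z, and for the factor 2. The total rate c r + 3 g is still below T.
  set g := (T - c * r) / 4 with hg
  have hg0 : 0 < g := by rw [hg]; linarith
  refine ⟨g / (Kp + 1), by positivity, fun z hz => ⟨c * (r + g / c) + g + g, ?_, ?_⟩⟩
  · rw [mul_add, mul_div_cancel₀ _ hc.ne']; linarith
  have h1 := ConeSequence.tendsto_rescaledLimit hKρ (by simp [D.depth_one]) x y
  have h2 := ConeSequence.tendsto_wordDist y z
  filter_upwards [h1.eventually (lt_mem_nhds h0),
    h1.eventually (gt_mem_nhds (lt_add_of_pos_right r (div_pos hg0 hc))),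
    h2.eventually (gt_mem_nhds hz),
    d.eventually_mul_exp_le 2 (lt_add_of_pos_right (c * (r + g / c) + g) hg0)] with k h3 h4 h5 h6
  have hd := d.pos k
  set u := (x.term k)⁻¹ * y.term k
  set v := (y.term k)⁻¹ * z.term k
  have huv : (x.term k)⁻¹ * z.term k = u * v := by simp only [u, v]; group
  -- Positive depth is essential: only inside the branch does the depth bound the height from below,
  -- and thus the scale of the affine action from above.
  have h3' : 0 < D.depth u := by
    rw [lt_div_iff₀ hd, zero_mul] at h3
    exact_mod_cast h3
  have h7 : |((p : ℝ) / q) ^ (D.height u).toAdd| ≤ Real.exp (c * (r + g / c) * d.toFun k) := by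
    have h8 : |((p : ℝ) / q) ^ (D.height u).toAdd| = |(q : ℝ) / p| ^ (-(D.height u).toAdd) := by
      rw [abs_zpow, zpow_neg, ← inv_zpow, ← abs_inv, inv_div]
    have h9 : |(q : ℝ) / p| ^ (-(D.height u).toAdd) ≤ |(q : ℝ) / p| ^ (D.depth u) :=
      zpow_le_zpow_right₀ hΛ.le (neg_le.1 (D.neg_depth_le_height u h3'))
    have h10 : |(q : ℝ) / p| ^ (D.depth u) = Real.exp (c * D.depth u) := by
      rw [← Real.rpow_intCast, Real.rpow_def_of_pos hΛ0]
    rw [h8]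
    refine h9.trans (h10.trans_le (Real.exp_le_exp.2 ?_))
    rw [mul_assoc]
    exact mul_le_mul_of_nonneg_left ((div_lt_iff₀ hd).1 h4).le hc.le
  have h11 : |D.pos v| ≤ 2 * Real.exp (g * d.toFun k) := by
    refine (hKp v).trans (mul_le_mul_of_nonneg_left (Real.exp_le_exp.2 ?_) two_pos.le)
    have h12 : S.wordDist 1 v = S.wordDist (y.term k) (z.term k) := by
      rw [← S.wordDist_mul_left (y.term k), mul_one, mul_inv_cancel_left]
    rw [h12]
    rw [div_lt_iff₀ hd] at h5
    refine (mul_le_mul_of_nonneg_left h5.le hKp0).trans ?_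
    rw [← mul_assoc, ← mul_div_assoc]
    refine mul_le_mul_of_nonneg_right ?_ hd.le
    rw [div_le_iff₀ (by positivity)]
    nlinarith
  rw [huv, D.pos_mul u v, abs_sub_comm, add_sub_cancel_left, abs_mul]
  refine ((mul_le_mul h7 h11 (abs_nonneg _) (Real.exp_pos _).le).trans (le_of_eq ?_)).trans h6
  rw [add_mul, Real.exp_add]; ring

end Labels

/-! ### The homomorphism to a free group and the loops that it detects -/

section Loops

open BaumslagSolitar

variable {G : Type} [Group G] {S : FiniteGeneratingSet G} {ω : Ultrafilter ℕ}
  {d : ScalingSequence ω} {e : ℕ → S.WordMetricSpace}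

/-- The cover of the asymptotic cone by the points of small and of positive depth yields a
homomorphism from the fundamental group to the free group on the position classes. -/
theorem exists_fundamentalGroup_hom_freeGroup {p q : ℤ} {a t : G} (D : Coordinates p q a t)
    (hB : IsBaumslagSolitar p q a t) (hp : p ≠ 0) (hpq : |p| < |q|)
    (x : ConeSequence S.WordMetricSpace ω d e) {δ : ℝ} (hδ : 0 < δ)
    {r : AsymptoticCone S.WordMetricSpace ω d e → ℝ} (hr : Continuous r)
    (hrx : ∀ y, r (SeparationQuotient.mk y) =
      ConeSequence.rescaledLimit (fun g => (D.depth g : ℝ)) x y) :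
    ∃ Φ : FundamentalGroup (AsymptoticCone S.WordMetricSpace ω d e) (SeparationQuotient.mk x) →*
        FreeGroup (Quotient (positionSetoid D.pos x (Real.log |(q : ℝ) / p| * δ))),
      ∀ (y z : ConeSequence S.WordMetricSpace ω d e)
        (γ₁ : Path (SeparationQuotient.mk x) (SeparationQuotient.mk y))
        (γ₂ : Path (SeparationQuotient.mk y) (SeparationQuotient.mk z))
        (γ₃ : Path (SeparationQuotient.mk z) (SeparationQuotient.mk x)),
        (∀ s, r (γ₁ s) < δ) → (∀ s, 0 < r (γ₂ s)) → (∀ s, r (γ₃ s) < δ) →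
        Φ (Path.Homotopic.Quotient.mk (γ₁.trans (γ₂.trans γ₃))) =
          (FreeGroup.of (Quotient.mk _ z))⁻¹ * FreeGroup.of (Quotient.mk _ y) := by
  set T := Real.log |(q : ℝ) / p| * δ
  have hc : 0 < Real.log |(q : ℝ) / p| := by
    have hp0 : (0 : ℝ) < |(p : ℝ)| := by exact_mod_cast abs_pos.2 hp
    refine Real.log_pos ?_
    rw [abs_div, one_lt_div hp0]
    exact_mod_cast hpq
  have loc : ∀ y, 0 < r (SeparationQuotient.mk y) → r (SeparationQuotient.mk y) < δ →
      ∃ μ > 0, ∀ z, dist y z < μ → positionSetoid D.pos x T y z := fun y h0 h1 => by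
    rw [hrx] at h0 h1
    exact exists_positionSetoid_of_dist_lt D hB hp hpq x y h0 (mul_lt_mul_of_pos_left h1 hc)
  -- The class of a chosen representative; by `loc` the choice does not matter where 0 < r < δ.
  let σ : AsymptoticCone S.WordMetricSpace ω d e → Quotient (positionSetoid D.pos x T) :=
    fun z => Quotient.mk _ (Quotient.out z)
  have hout : ∀ z : AsymptoticCone S.WordMetricSpace ω d e,
      SeparationQuotient.mk (Quotient.out z) = z := fun z => Quotient.out_eq z
  have hσ : ∀ y, 0 < r (SeparationQuotient.mk y) → r (SeparationQuotient.mk y) < δ →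
      ∀ᶠ z in 𝓝 (SeparationQuotient.mk y : AsymptoticCone S.WordMetricSpace ω d e),
        σ z = Quotient.mk _ y := fun y h0 h1 => by
    obtain ⟨μ, hμ, h⟩ := loc y h0 h1
    filter_upwards [Metric.ball_mem_nhds _ hμ] with z hz
    refine (Quotient.sound (h _ ?_)).symm
    rw [Metric.mem_ball, dist_comm, ← hout z, SeparationQuotient.dist_mk] at hz
    exact hz
  have hx0 : r (SeparationQuotient.mk x) = 0 := by
    rw [hrx]
    refine tendsto_nhds_unique (f := fun k => ((D.depth ((x.term k)⁻¹ * x.term k) : ℤ) : ℝ) /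
      d.toFun k) (l := (ω : Filter ℕ)) ?_ ?_
    · obtain ⟨Kρ, -, hKρ⟩ := D.exists_depth_lipschitz S hB
      exact ConeSequence.tendsto_rescaledLimit hKρ (by simp [D.depth_one]) x x
    · simp [D.depth_one]
  obtain ⟨Φ, hΦ⟩ := exists_fundamentalGroup_hom (A := {z | r z < δ}) (B := {z | 0 < r z})
    (σ := fun z => FreeGroup.of (σ z)) (isOpen_lt hr continuous_const)
    (isOpen_lt continuous_const hr)
    (Set.eq_univ_of_forall fun z => by
      rcases lt_or_ge (r z) δ with h | h
      exacts [Or.inl h, Or.inr (hδ.trans_le h)])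
    (fun z hz => by
      rw [← hout z] at hz ⊢
      have := hσ _ hz.2 hz.1
      rw [this.self_of_nhds]
      filter_upwards [this] with w hw
      rw [hw])
    (x := SeparationQuotient.mk x) (by simpa [hx0] using hδ)
  refine ⟨Φ, fun y z γ₁ γ₂ γ₃ h1 h2 h3 => ?_⟩
  rw [hΦ _ _ γ₁ γ₂ γ₃ h1 h2 h3]
  have e1 := h1 1
  have e2 := h2 0
  have e3 := h2 1
  have e4 := h3 0
  rw [γ₁.target] at e1
  rw [γ₂.source] at e2
  rw [γ₂.target] at e3
  rw [γ₃.source] at e4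
  simp only [(hσ y e2 e1).self_of_nhds, (hσ z e3 e4).self_of_nhds]

theorem exists_coneCurve (x : ConeSequence S.WordMetricSpace ω d e)
    (W : ℕ → ℕ → G) {K : ℝ} (hK : 0 ≤ K)
    (hW0 : ∃ M, ∀ᶠ k in (ω : Filter ℕ), S.wordDist 1 (W k 0) ≤ M * d.toFun k)
    (hW : ∀ k i, S.wordDist (W k i) (W k (i + 1)) ≤ K) :
    ∃ y : ℝ → ConeSequence S.WordMetricSpace ω d e,
      (∀ s k, (y s).term k = x.term k * W k ⌊s * d.toFun k⌋₊) ∧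
      (∀ s s', dist (y s) (y s') ≤ K * |s - s'|) ∧
      Continuous fun s => (SeparationQuotient.mk (y s) :
        AsymptoticCone S.WordMetricSpace ω d e) := by
  have h := dist_coneCurveSequence_le x W hK hW0 hW
  refine ⟨coneCurveSequence x W hK hW0 hW, fun s k => rfl, h, ?_⟩
  have : LipschitzWith K.toNNReal (coneCurveSequence x W hK hW0 hW) :=
    LipschitzWith.of_dist_le' h
  exact SeparationQuotient.continuous_mk.comp this.continuous

theorem ScalingSequence.tendsto_floor_div (d : ScalingSequence ω) {s : ℝ} (hs : 0 ≤ s) :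
    Tendsto (fun k => (⌊s * d.toFun k⌋₊ : ℝ) / d.toFun k) (ω : Filter ℕ) (𝓝 s) :=
  (tendsto_nat_floor_mul_div_atTop hs).comp d.tendsto_atTop

theorem ScalingSequence.eventually_floor_lt (d : ScalingSequence ω) {s s' : ℝ} (hs : 0 ≤ s)
    (h : s < s') : ∀ᶠ k in (ω : Filter ℕ), ⌊s * d.toFun k⌋₊ < ⌊s' * d.toFun k⌋₊ := by
  filter_upwards [(d.tendsto_floor_div hs).eventually_lt (d.tendsto_floor_div (hs.trans h.le)) h]
    with k hk
  exact_mod_cast (div_lt_div_iff_of_pos_right (d.pos k)).1 hk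

/-- The loop that follows one curve and returns along another one, divided into three parts. -/
theorem exists_paths_of_curves {X : Type*} [MetricSpace X] {x : X} {r : X → ℝ} {c₁ c₂ : ℝ → X}
    (hc₁ : Continuous c₁) (hc₂ : Continuous c₂) {u w L δ b : ℝ} (hu : 0 ≤ u) (huw : u ≤ w)
    (hwL : w ≤ L) (h10 : x = c₁ 0) (h20 : x = c₂ 0) (h12 : c₂ L = c₁ L)
    (hr₁ : ∀ s ∈ Set.Icc 0 u, r (c₁ s) < δ) (hr₂ : ∀ s ∈ Set.Icc u w, 0 < r (c₁ s))
    (hr₃ : ∀ s ∈ Set.Icc w L, r (c₁ s) < δ) (hr₄ : ∀ s, r (c₂ s) < δ)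
    (hb₁ : ∀ s ∈ Set.Icc 0 L, dist (c₁ s) x ≤ b) (hb₂ : ∀ s ∈ Set.Icc 0 L, dist (c₂ s) x ≤ b) :
    ∃ (γ₁ : Path x (c₁ u)) (γ₂ : Path (c₁ u) (c₁ w)) (γ₃ : Path (c₁ w) x),
      (∀ s, r (γ₁ s) < δ) ∧ (∀ s, 0 < r (γ₂ s)) ∧ (∀ s, r (γ₃ s) < δ) ∧
      ∀ s, dist (γ₁.trans (γ₂.trans γ₃) s) x ≤ b := by
  obtain ⟨γ₁, v₁⟩ : ∃ γ : Path x (c₁ u), ∀ s, ∃ v ∈ Set.Icc 0 u, γ s = c₁ v := by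
    refine ⟨(curvePath hc₁ 0 u).cast h10 rfl, fun s => ?_⟩
    have := exists_curvePath_eq hc₁ 0 u s
    rwa [min_eq_left hu, max_eq_right hu] at this
  obtain ⟨γ₂, v₂⟩ : ∃ γ : Path (c₁ u) (c₁ w), ∀ s, ∃ v ∈ Set.Icc u w, γ s = c₁ v := by
    refine ⟨curvePath hc₁ u w, fun s => ?_⟩
    have := exists_curvePath_eq hc₁ u w s
    rwa [min_eq_left huw, max_eq_right huw] at this
  obtain ⟨γ₃, v₃⟩ : ∃ γ : Path (c₁ w) (c₁ L), ∀ s, ∃ v ∈ Set.Icc w L, γ s = c₁ v := by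
    refine ⟨curvePath hc₁ w L, fun s => ?_⟩
    have := exists_curvePath_eq hc₁ w L s
    rwa [min_eq_left hwL, max_eq_right hwL] at this
  have hL := (hu.trans huw).trans hwL
  obtain ⟨γ₄, v₄⟩ : ∃ γ : Path (c₁ L) x, ∀ s, ∃ v ∈ Set.Icc 0 L, γ s = c₂ v := by
    refine ⟨(curvePath hc₂ L 0).cast h12.symm h20, fun s => ?_⟩
    have := exists_curvePath_eq hc₂ L 0 s
    rwa [min_eq_right hL, max_eq_left hL] at this
  have cases₃ : ∀ s, (∃ s', γ₃ s' = γ₃.trans γ₄ s) ∨ ∃ s', γ₄ s' = γ₃.trans γ₄ s := fun s => by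
    have hs : γ₃.trans γ₄ s ∈ Set.range (γ₃.trans γ₄) := ⟨s, rfl⟩
    rwa [Path.trans_range] at hs
  refine ⟨γ₁, γ₂, γ₃.trans γ₄, fun s => ?_, fun s => ?_, fun s => ?_, fun s => ?_⟩
  · obtain ⟨v, hv, h⟩ := v₁ s
    rw [h]; exact hr₁ v hv
  · obtain ⟨v, hv, h⟩ := v₂ s
    rw [h]; exact hr₂ v hv
  · rcases cases₃ s with ⟨s', hs⟩ | ⟨s', hs⟩
    · obtain ⟨v, hv, h⟩ := v₃ s'
      rw [← hs, h]; exact hr₃ v hv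
    · obtain ⟨v, hv, h⟩ := v₄ s'
      rw [← hs, h]; exact hr₄ v
  · have hs : γ₁.trans (γ₂.trans (γ₃.trans γ₄)) s ∈
        Set.range (γ₁.trans (γ₂.trans (γ₃.trans γ₄))) := ⟨s, rfl⟩
    rw [Path.trans_range, Path.trans_range, Path.trans_range] at hs
    rcases hs with ⟨s', hs⟩ | ⟨s', hs⟩ | ⟨s', hs⟩ | ⟨s', hs⟩
    · obtain ⟨v, hv, h⟩ := v₁ s'
      rw [← hs, h]; exact hb₁ v ⟨hv.1, (hv.2.trans huw).trans hwL⟩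
    · obtain ⟨v, hv, h⟩ := v₂ s'
      rw [← hs, h]; exact hb₁ v ⟨hu.trans hv.1, hv.2.trans hwL⟩
    · obtain ⟨v, hv, h⟩ := v₃ s'
      rw [← hs, h]; exact hb₁ v ⟨(hu.trans huw).trans hv.1, hv.2⟩
    · obtain ⟨v, hv, h⟩ := v₄ s'
      rw [← hs, h]; exact hb₂ v hv

/-- The loop in the asymptotic cone that climbs into a branch of depth `κ` along the words `W k`
and returns along their translates by `a`. -/
theorem exists_branch_loop {p q : ℤ} {a t : G} (D : Coordinates p q a t)
    (hB : IsBaumslagSolitar p q a t) (x : ConeSequence S.WordMetricSpace ω d e)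
    {r : AsymptoticCone S.WordMetricSpace ω d e → ℝ}
    (hrx : ∀ y, r (SeparationQuotient.mk y) =
      ConeSequence.rescaledLimit (fun g => (D.depth g : ℝ)) x y)
    {κ τ δ : ℝ} (hτ0 : 0 < τ) (hτκ : τ < κ) (hτδ : τ < δ) (W : ℕ → ℕ → G) (N : ℕ → ℤ)
    {K : ℝ} (hK : 0 ≤ K) (hW : ∀ k i, S.wordDist (W k i) (W k (i + 1)) ≤ K)
    (hW0 : ∀ k, W k 0 = 1)
    (hWN : ∀ k i, ⌊κ * d.toFun k⌋₊ < i → W k i = a ^ N k * t⁻¹ ^ (2 * ⌊κ * d.toFun k⌋₊ - i))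
    (hd1 : ∀ k, ∀ i ≤ ⌊κ * d.toFun k⌋₊, D.depth (W k i) = i)
    (hd2 : ∀ k i, ⌊κ * d.toFun k⌋₊ < i →
      D.depth (W k i) = (2 * ⌊κ * d.toFun k⌋₊ - i : ℕ))
    (hd3 : ∀ k i, D.depth (a * W k i) = 0) :
    ∃ (y z : ConeSequence S.WordMetricSpace ω d e)
      (γ₁ : Path (SeparationQuotient.mk x) (SeparationQuotient.mk y))
      (γ₂ : Path (SeparationQuotient.mk y) (SeparationQuotient.mk z))
      (γ₃ : Path (SeparationQuotient.mk z) (SeparationQuotient.mk x)),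
      (∀ s, r (γ₁ s) < δ) ∧ (∀ s, 0 < r (γ₂ s)) ∧ (∀ s, r (γ₃ s) < δ) ∧
      (∀ s, dist (γ₁.trans (γ₂.trans γ₃) s) (SeparationQuotient.mk x) ≤ K * (2 * κ)) ∧
      (∀ k, y.term k = x.term k * W k ⌊τ * d.toFun k⌋₊) ∧
      ∀ k, z.term k = x.term k * W k ⌊(2 * κ - τ) * d.toFun k⌋₊ := by
  have hκ := hτ0.trans hτκ
  have hδ := hτ0.trans hτδ
  obtain ⟨Kρ, -, hKρ⟩ := D.exists_depth_lipschitz S hB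
  have hb1 : ∃ M, ∀ᶠ k in (ω : Filter ℕ), S.wordDist 1 (W k 0) ≤ M * d.toFun k :=
    ⟨0, by simp [hW0, S.wordDist_self]⟩
  have hb2 : ∃ M, ∀ᶠ k in (ω : Filter ℕ), S.wordDist 1 (a * W k 0) ≤ M * d.toFun k := by
    refine ⟨S.wordDist 1 a, ?_⟩
    filter_upwards [d.tendsto_atTop.eventually_ge_atTop 1] with k hk
    rw [hW0, mul_one]
    exact le_mul_of_one_le_right (S.wordDist_nonneg _ _) hk
  have hW' : ∀ k i, S.wordDist (a * W k i) (a * W k (i + 1)) ≤ K := fun k i => by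
    rw [S.wordDist_mul_left]; exact hW k i
  obtain ⟨y₁, t₁, l₁, hc₁⟩ := exists_coneCurve x W hK hb1 hW
  obtain ⟨y₂, t₂, l₂, hc₂⟩ := exists_coneCurve x (fun k i => a * W k i) hK hb2 hW'
  have h10 : SeparationQuotient.mk x = SeparationQuotient.mk (y₁ 0) :=
    ConeSequence.mk_eq_mk (b := 0) (Eventually.of_forall fun k => by
      simp only [t₁]
      simp [hW0, S.wordDist_self])
  have h20 : SeparationQuotient.mk x = SeparationQuotient.mk (y₂ 0) :=
    ConeSequence.mk_eq_mk (b := S.wordDist 1 a) (Eventually.of_forall fun k => by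
      simp only [t₂, S.wordDist_mul_right]
      simp [hW0])
  have h12 : SeparationQuotient.mk (y₂ (2 * κ)) = SeparationQuotient.mk (y₁ (2 * κ)) :=
    ConeSequence.mk_eq_mk (b := S.wordDist 1 a) (by
      filter_upwards [d.eventually_floor_lt hκ.le (by linarith : κ < 2 * κ)] with k hk
      -- At time 2κ the exponent of t⁻¹ is 0, so the curves end at a^N and a^(N+1), a bounded
      -- distance apart.
      have h1 : 2 * ⌊κ * d.toFun k⌋₊ - ⌊2 * κ * d.toFun k⌋₊ = 0 := by
        refine Nat.sub_eq_zero_of_le (Nat.le_floor ?_)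
        have := Nat.floor_le (mul_pos hκ (d.pos k)).le
        push_cast
        linarith
      simp only [t₁, t₂, S.wordDist_mul_left, hWN k _ hk, h1, pow_zero,
        mul_one]
      rw [← zpow_one_add, add_comm, zpow_add_one, S.wordDist_comm, S.wordDist_mul_right])
  have lim : ∀ (y : ConeSequence S.WordMetricSpace ω d e) (l : ℝ),
      Tendsto (fun k => (D.depth ((x.term k)⁻¹ * y.term k) : ℝ) / d.toFun k) (ω : Filter ℕ) (𝓝 l) →
      r (SeparationQuotient.mk y) = l := fun y l h => by
    rw [hrx]
    exact tendsto_nhds_unique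
      (ConeSequence.tendsto_rescaledLimit hKρ (by simp [D.depth_one]) x y) h
  have r₁ : ∀ s, 0 ≤ s → s ≤ κ → r (SeparationQuotient.mk (y₁ s)) = s := fun s h0 h1 => lim _ _ (by
    refine (d.tendsto_floor_div h0).congr fun k => ?_
    simp only [t₁, inv_mul_cancel_left]
    rw [hd1 k _ (Nat.floor_mono (mul_le_mul_of_nonneg_right h1 (d.pos k).le)), Int.cast_natCast])
  have r₁' : ∀ s, κ < s → r (SeparationQuotient.mk (y₁ s)) = max (2 * κ - s) 0 := fun s h0 => lim _ _ (by
    have h1 := ((((d.tendsto_floor_div hκ.le).const_mul 2).sub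
      (d.tendsto_floor_div (hκ.trans h0).le)).max (tendsto_const_nhds (x := (0 : ℝ))))
    refine h1.congr' ?_
    filter_upwards [d.eventually_floor_lt hκ.le h0] with k hk
    simp only [t₁, inv_mul_cancel_left]
    rw [hd2 k _ hk, Int.cast_natCast, ← mul_div_assoc, ← sub_div,
      ← zero_div (d.toFun k), max_div_div_right (d.pos k).le]
    congr 1
    rcases le_total ⌊s * d.toFun k⌋₊ (2 * ⌊κ * d.toFun k⌋₊) with h | h
    · rw [Nat.cast_sub h, max_eq_left]
      · push_cast; ring
      · rw [sub_nonneg]; exact_mod_cast h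
    · rw [Nat.sub_eq_zero_of_le h, max_eq_right, Nat.cast_zero]
      rw [sub_nonpos]; exact_mod_cast h)
  have r₂ : ∀ s, r (SeparationQuotient.mk (y₂ s)) = 0 := fun s => lim _ _ (by
    simp only [t₂, inv_mul_cancel_left, hd3]
    simp)
  have dist₁ : ∀ s, 0 ≤ s → s ≤ 2 * κ →
      dist (SeparationQuotient.mk (y₁ s)) (SeparationQuotient.mk x) ≤ K * (2 * κ) := by
    intro s h0 h1
    rw [h10, SeparationQuotient.dist_mk]
    refine (l₁ s 0).trans (mul_le_mul_of_nonneg_left ?_ hK)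
    rwa [sub_zero, abs_of_nonneg h0]
  have dist₂ : ∀ s, 0 ≤ s → s ≤ 2 * κ →
      dist (SeparationQuotient.mk (y₂ s)) (SeparationQuotient.mk x) ≤ K * (2 * κ) := by
    intro s h0 h1
    rw [h20, SeparationQuotient.dist_mk]
    refine (l₂ s 0).trans (mul_le_mul_of_nonneg_left ?_ hK)
    rwa [sub_zero, abs_of_nonneg h0]
  obtain ⟨γ₁, γ₂, γ₃, h1, h2, h3, h4⟩ := exists_paths_of_curves (r := r) (δ := δ) hc₁ hc₂ hτ0.le
    (by linarith : τ ≤ 2 * κ - τ) (by linarith : 2 * κ - τ ≤ 2 * κ) h10 h20 h12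
    (fun s hs => by rw [r₁ s hs.1 (by linarith [hs.2])]; linarith [hs.2])
    (fun s hs => by
      rcases le_or_gt s κ with h | h
      · rw [r₁ s (by linarith [hs.1]) h]; linarith [hs.1]
      · rw [r₁' s h]; exact lt_max_of_lt_left (by linarith [hs.2]))
    (fun s hs => by
      rw [r₁' s (by linarith [hs.1])]
      exact max_lt (by linarith [hs.1]) hδ)
    (fun s => by rw [r₂]; exact hδ) (fun s hs => dist₁ s hs.1 hs.2) (fun s hs => dist₂ s hs.1 hs.2)
  exact ⟨y₁ τ, y₁ (2 * κ - τ), γ₁, γ₂, γ₃, h1, h2, h3, h4, t₁ τ, t₁ (2 * κ - τ)⟩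

end Loops

open BaumslagSolitar in
/-- Every point of an asymptotic cone is the base point of arbitrarily small loops, parametrized
by a real interval, that are distinguished by a homomorphism to a free group. -/
theorem IsBaumslagSolitar.exists_small_loops {G : Type} [Group G] {p q : ℤ} {a t : G}
    (hB : IsBaumslagSolitar p q a t) (hp : p ≠ 0) (hpq : |p| < |q|) {S : FiniteGeneratingSet G}
    {ω : Ultrafilter ℕ} {d : ScalingSequence ω} {e : ℕ → S.WordMetricSpace}
    (x₀ : AsymptoticCone S.WordMetricSpace ω d e) {ε : ℝ} (hε : 0 < ε) :
    ∃ (T : Type) (Φ : FundamentalGroup (AsymptoticCone S.WordMetricSpace ω d e) x₀ →* FreeGroup T)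
      (γ : Set.Icc (0 : ℝ) 1 → Path x₀ x₀) (s : T) (σ : Set.Icc (0 : ℝ) 1 → T),
      Function.Injective σ ∧ (∀ θ u, dist (γ θ u) x₀ < ε) ∧
      ∀ θ, Φ (Path.Homotopic.Quotient.mk (γ θ)) = (FreeGroup.of (σ θ))⁻¹ * FreeGroup.of s := by
  obtain ⟨D⟩ := exists_coordinates hB hp hpq
  have hp0 : (0 : ℝ) < |(p : ℝ)| := by exact_mod_cast abs_pos.2 hp
  have hΛ : 1 < |(q : ℝ) / p| := by
    rw [abs_div, one_lt_div hp0]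
    exact_mod_cast hpq
  have hΛ0 : 0 < |(q : ℝ) / p| := one_pos.trans hΛ
  have hq1 : (1 : ℝ) ≤ |(q : ℝ)| := by
    have : (1 : ℤ) ≤ |q| := by have := abs_nonneg p; omega
    exact_mod_cast this
  have hc : 0 < Real.log |(q : ℝ) / p| := Real.log_pos hΛ
  obtain ⟨c, hcdef⟩ : ∃ c, c = Real.log |(q : ℝ) / p| := ⟨_, rfl⟩
  rw [← hcdef] at hc
  have hpow : ∀ i : ℕ, |(q : ℝ) / p| ^ i = Real.exp (c * i) := fun i => by
    rw [hcdef, mul_comm, Real.exp_nat_mul, Real.exp_log hΛ0]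
  -- In the constant, |q| is due to N being a multiple of q, and |q/p| to rounding κ d_k down to m.
  obtain ⟨K, hK, hpath⟩ := exists_branch_path hB D S hp hpq (|(q : ℝ)| * |(q : ℝ) / p|)
  obtain ⟨κ, hκ, hκε⟩ : ∃ κ > 0, K * (2 * κ) < ε := by
    refine ⟨ε / (2 * (K + 1)), by positivity, ?_⟩
    rw [← mul_div_assoc, ← mul_div_assoc, div_lt_iff₀ (by positivity)]
    nlinarith
  obtain ⟨x, rfl⟩ := SeparationQuotient.surjective_mk x₀
  obtain ⟨Kρ, -, hKρ⟩ := D.exists_depth_lipschitz S hB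
  obtain ⟨r, hr, hrx⟩ := ConeSequence.exists_continuous_rescaledLimit hKρ (by simp [D.depth_one]) x
  have hΦ := exists_fundamentalGroup_hom_freeGroup D hB hp hpq x (half_pos hκ) hr hrx
  rw [← hcdef] at hΦ
  obtain ⟨Φ, hΦ⟩ := hΦ
  let m : ℕ → ℕ := fun k => ⌊κ * d.toFun k⌋₊
  let N : Set.Icc (0 : ℝ) 1 → ℕ → ℤ := fun θ k => q * ⌊θ.1 * Real.exp (c * (κ * d.toFun k))⌋
  have hN : ∀ θ k, |(N θ k : ℝ)| ≤ |(q : ℝ)| * |(q : ℝ) / p| * |(q : ℝ) / p| ^ m k := fun θ k => by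
    have h0 : 0 ≤ θ.1 * Real.exp (c * (κ * d.toFun k)) :=
      mul_nonneg θ.2.1 (Real.exp_pos _).le
    have h1 : (⌊θ.1 * Real.exp (c * (κ * d.toFun k))⌋ : ℝ) ≤ Real.exp (c * (κ * d.toFun k)) :=
      (Int.floor_le _).trans (mul_le_of_le_one_left (Real.exp_pos _).le θ.2.2)
    have h2 : Real.exp (c * (κ * d.toFun k)) ≤ |(q : ℝ) / p| ^ (m k + 1) := by
      rw [hpow]
      refine Real.exp_le_exp.2 (mul_le_mul_of_nonneg_left ?_ hc.le)
      push_cast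
      exact (Nat.lt_floor_add_one _).le
    have h3 : (0 : ℝ) ≤ ⌊θ.1 * Real.exp (c * (κ * d.toFun k))⌋ := by
      exact_mod_cast Int.floor_nonneg.2 h0
    simp only [N]
    push_cast
    rw [abs_mul, mul_assoc, ← pow_succ', abs_of_nonneg h3]
    exact mul_le_mul_of_nonneg_left (h1.trans h2) (abs_nonneg _)
  choose W hW0 hWN hd1 hd2 hd3 hWK hpos1 hpos2 using fun θ k =>
    hpath (N θ k) (m k) (dvd_mul_right _ _) (hN θ k)
  have hτ : 0 < κ / 4 := by linarith
  choose y z γ₁ γ₂ γ₃ h1 h2 h3 hdist hy hz using fun θ =>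
    exists_branch_loop D hB x hrx hτ (by linarith : κ / 4 < κ) (by linarith : κ / 4 < κ / 2)
      (W θ) (N θ) hK (hWK θ) (hW0 θ) (hWN θ) (hd1 θ) (hd2 θ) (hd3 θ)
  have hzN : ∀ θ, ∀ᶠ k in (ω : Filter ℕ), D.pos ((x.term k)⁻¹ * (z θ).term k) = N θ k := fun θ => by
    filter_upwards [d.eventually_floor_lt hκ.le (by linarith : κ < 2 * κ - κ / 4)] with k hk
    rw [hz, inv_mul_cancel_left, hpos2 θ k _ hk]
  -- At depth κ/4 on the way in the position has rate at most cκ/4. The rate 3cκ/8 absorbs K and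
  -- stays below the threshold cκ/2, so this crossing has the class of x for every θ.
  have hyx : ∀ θ, positionSetoid D.pos x (c * (κ / 2)) (y θ) x := fun θ => by
    refine ⟨c * (3 / 8 * κ), mul_lt_mul_of_pos_left (by linarith) hc, ?_⟩
    filter_upwards [d.eventually_mul_exp_le K (mul_lt_mul_of_pos_left
      (by linarith : κ / 4 < 3 / 8 * κ) hc)] with k hk
    have hd := d.pos k
    rw [hy, inv_mul_cancel_left, inv_mul_cancel, D.pos_one, sub_zero]
    refine (hpos1 θ k _ (Nat.floor_mono (mul_le_mul_of_nonneg_right (by linarith) hd.le))).trans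
      (le_trans (mul_le_mul_of_nonneg_left ?_ hK) hk)
    rw [hpow, mul_assoc]
    exact Real.exp_le_exp.2 (mul_le_mul_of_nonneg_left
      (Nat.floor_le (mul_pos hτ hd).le) hc.le)
  refine ⟨_, Φ, fun θ => (γ₁ θ).trans ((γ₂ θ).trans (γ₃ θ)), Quotient.mk _ x,
    fun θ => Quotient.mk _ (z θ), fun θ θ' h => ?_, fun θ u => (hdist θ u).trans_lt hκε,
    fun θ => ?_⟩
  · obtain ⟨η, hη, hle⟩ := Quotient.exact h
    by_contra hne
    have hθ : 0 < |θ.1 - θ'.1| := abs_pos.2 (sub_ne_zero.2 fun h => hne (Subtype.ext h))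
    have hη' : η < c * κ := hη.trans (mul_lt_mul_of_pos_left (by linarith) hc)
    -- For large k both exp(η d_k) and 1 are at most a third of |θ - θ'| E. Equal classes and
    -- rounding would give |θ - θ'| E ≤ exp(η d_k) + 1.
    have h4 := d.eventually_mul_exp_le (3 / |θ.1 - θ'.1|) hη'
    have h5 := d.eventually_mul_exp_le (3 / |θ.1 - θ'.1|) (mul_pos hc hκ)
    obtain ⟨k, h6, h7, h8, h9, h10⟩ :=
      ((hzN θ).and ((hzN θ').and (hle.and (h4.and h5)))).exists
    rw [h6, h7] at h8
    rw [zero_mul, Real.exp_zero, div_mul_eq_mul_div, div_le_iff₀ hθ] at h10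
    rw [div_mul_eq_mul_div, div_le_iff₀ hθ] at h9
    simp only [N, ← mul_assoc] at h8
    set E := Real.exp (c * κ * d.toFun k)
    have hE : 0 < E := Real.exp_pos _
    have h11 : |(⌊θ.1 * E⌋ : ℝ) - ⌊θ'.1 * E⌋| ≤ Real.exp (η * d.toFun k) := by
      refine (le_mul_of_one_le_left (abs_nonneg _) hq1).trans ?_
      rw [← abs_mul, mul_sub]
      push_cast at h8
      exact h8
    have h12 : |θ.1 - θ'.1| * E ≤ |(⌊θ.1 * E⌋ : ℝ) - ⌊θ'.1 * E⌋| + 1 := by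
      rw [← abs_of_pos hE, ← abs_mul, abs_of_pos hE, sub_mul]
      have e1 := Int.floor_le (θ.1 * E)
      have e2 := Int.lt_floor_add_one (θ.1 * E)
      have e3 := Int.floor_le (θ'.1 * E)
      have e4 := Int.lt_floor_add_one (θ'.1 * E)
      have e5 := abs_le.1 (le_refl |(⌊θ.1 * E⌋ : ℝ) - ⌊θ'.1 * E⌋|)
      rw [abs_le]
      constructor <;> linarith [e5.1, e5.2]
    nlinarith
  · rw [hΦ _ _ _ _ _ (h1 θ) (h2 θ) (h3 θ), Quotient.sound (hyx θ)]

/-! ### Consequences for the fundamental group -/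

/-- A group with uncountable image in a free group contains an uncountable free subgroup. -/
theorem IsFreeGroup.exists_uncountable_subgroup {P T : Type} [Group P] {ι : Type} [Uncountable ι]
    {Φ : P →* FreeGroup T} {g : ι → P} (hg : Function.Injective fun i => Φ (g i)) :
    ∃ F : Subgroup P, IsFreeGroup F ∧ Uncountable F := by
  have hfree : IsFreeGroup Φ.range := subgroupIsFreeOfIsFree _
  have hunc : Uncountable Φ.range := Function.Injective.uncountable
    (f := fun i => (⟨Φ (g i), g i, rfl⟩ : Φ.range)) fun i j h => hg (congrArg Subtype.val h)
  choose s hs using fun x : IsFreeGroup.Generators Φ.range => Φ.rangeRestrict_surjective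
    (IsFreeGroup.of x)
  -- By the Nielsen–Schreier theorem the range is free, so Φ splits over it.
  let ψ : Φ.range →* P := IsFreeGroup.lift s
  have hψ : Φ.rangeRestrict.comp ψ = MonoidHom.id _ := by
    refine IsFreeGroup.ext_hom fun x => ?_
    simp [ψ, hs]
  have hinj : Function.Injective ψ := fun x y h => by
    have := congrArg Φ.rangeRestrict h
    rwa [← MonoidHom.comp_apply, ← MonoidHom.comp_apply, hψ] at this
  exact ⟨ψ.range, IsFreeGroup.ofMulEquiv (MonoidHom.ofInjective hinj),
    (MonoidHom.ofInjective hinj).toEquiv.uncountable_iff.1 hunc⟩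

/-- A group is not simple if it is uncountable and has a nontrivial homomorphism to `ℤ` that factors
through a free group. -/
theorem not_isSimpleGroup_of_hom_freeGroup {P T : Type} [Group P] [Uncountable P]
    {Φ : P →* FreeGroup T} {g : P} {s u : T} (hsu : u ≠ s)
    (hg : Φ g = (FreeGroup.of u)⁻¹ * FreeGroup.of s) : ¬ IsSimpleGroup P := by
  classical
  intro hP
  let χ : P →* Multiplicative ℤ := (FreeGroup.lift fun x => Multiplicative.ofAdd
    (if x = s then (1 : ℤ) else 0)).comp Φ
  have hχ : χ g ≠ 1 := by
    simp [χ, hg, hsu]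
  rcases hP.eq_bot_or_eq_top_of_normal χ.ker inferInstance with h | h
  -- A trivial kernel would embed the uncountable group in ℤ.
  · exact not_countable ((MonoidHom.ker_eq_bot_iff χ).1 h).countable
  · exact hχ (χ.mem_ker.1 (h ▸ Subgroup.mem_top g))

/-- The asymptotic cones of a Baumslag–Solitar group with `|p| < |q|` and their fundamental groups.
-/
theorem IsBaumslagSolitar.asymptoticCone {G : Type} [Group G] {p q : ℤ} {a t : G}
    (hB : IsBaumslagSolitar p q a t) (hp : p ≠ 0) (hpq : |p| < |q|) (S : FiniteGeneratingSet G)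
    (ω : Ultrafilter ℕ) (d : ScalingSequence ω) (e : ℕ → S.WordMetricSpace) :
    ¬ IsSemilocallySimplyConnected (AsymptoticCone S.WordMetricSpace ω d e) ∧
    ∀ x₀ : AsymptoticCone S.WordMetricSpace ω d e,
      ¬ IsSimpleGroup (FundamentalGroup (AsymptoticCone S.WordMetricSpace ω d e) x₀) ∧
      (∀ (ι : Type*)
          (H : ι → Subgroup (FundamentalGroup (AsymptoticCone S.WordMetricSpace ω d e) x₀)),
          IsInternalFreeProduct H → ∃ i, ¬ IsFreeGroup (H i) ∧ Uncountable (H i)) ∧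
      ∃ F : Subgroup (FundamentalGroup (AsymptoticCone S.WordMetricSpace ω d e) x₀),
        IsFreeGroup F ∧ Uncountable F := by
  have unc : Uncountable (Set.Icc (0 : ℝ) 1) := by
    rw [← not_countable_iff, Set.countable_coe_iff]
    exact Cardinal.Real.Icc_countable_iff.not.2 (by norm_num)
  have key := fun x₀ : AsymptoticCone S.WordMetricSpace ω d e =>
    fun ε (hε : 0 < ε) => hB.exists_small_loops hp hpq x₀ hε
  have inj : ∀ {T : Type} {σ : Set.Icc (0 : ℝ) 1 → T} {s : T}, Function.Injective σ →
      Function.Injective fun θ => (FreeGroup.of (σ θ))⁻¹ * FreeGroup.of s := fun hσ θ θ' h =>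
    hσ (FreeGroup.of_injective (inv_injective (mul_right_cancel h)))
  have ne : ∀ {T : Type} {σ : Set.Icc (0 : ℝ) 1 → T} (s : T), Function.Injective σ →
      ∃ θ, σ θ ≠ s := fun s hσ => by
    by_contra! h
    have := hσ ((h ⟨0, by norm_num⟩).trans (h ⟨1, by norm_num⟩).symm)
    simp at this
  constructor
  · intro hC
    let x₀ : AsymptoticCone S.WordMetricSpace ω d e := SeparationQuotient.mk ⟨e, 1, by simp⟩
    obtain ⟨U, hU, h⟩ := hC x₀
    obtain ⟨ε, hε, hεU⟩ := Metric.mem_nhds_iff.1 hU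
    obtain ⟨T, Φ, γ, s, σ, hσ, hγ, hΦ⟩ := key x₀ ε hε
    obtain ⟨θ, hθ⟩ := ne s hσ
    have h1 := h (γ θ) (by rintro _ ⟨u, rfl⟩; exact hεU (hγ θ u))
    have h2 : Φ (Path.Homotopic.Quotient.mk (γ θ)) = 1 := by
      rw [Path.Homotopic.Quotient.eq.2 h1]
      exact Φ.map_one
    rw [hΦ θ, inv_mul_eq_one] at h2
    exact hθ (FreeGroup.of_injective h2)
  · intro x₀
    have large : ∀ r, ∀ hr : 0 < r, Uncountable (loopSubgroup x₀ r hr) := fun r hr => by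
      obtain ⟨T, Φ, γ, s, σ, hσ, hγ, hΦ⟩ := key x₀ r hr
      refine Function.Injective.uncountable (f := fun θ =>
        (⟨Path.Homotopic.Quotient.mk (γ θ), γ θ, hγ θ, rfl⟩ : loopSubgroup x₀ r hr))
        fun θ θ' h => inj (s := s) hσ ?_
      have h1 := congrArg (fun g => Φ g.1) h
      simp only [hΦ] at h1
      exact h1
    have huncP : Uncountable (FundamentalGroup _ x₀) :=
      have := large 1 one_pos
      (Subtype.val_injective (p := fun g => g ∈ loopSubgroup x₀ 1 one_pos)).uncountable
    obtain ⟨T, Φ, γ, s, σ, hσ, hγ, hΦ⟩ := key x₀ 1 one_pos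
    obtain ⟨θ, hθ⟩ := ne s hσ
    refine ⟨not_isSimpleGroup_of_hom_freeGroup hθ (hΦ θ),
      fun ι H hH => hH.exists_not_isFreeGroup_uncountable large,
      IsFreeGroup.exists_uncountable_subgroup (Φ := Φ)
        (g := fun θ => Path.Homotopic.Quotient.mk (γ θ)) ?_⟩
    simp only [hΦ]
    exact inj hσ

theorem mainTheorem9 (p q : ℤ) (hp : p ≠ 0) (hq : q ≠ 0) (hpq : |p| ≠ |q|)
    (S : FiniteGeneratingSet (BaumslagSolitar p q)) (ω : Ultrafilter ℕ) (d : ScalingSequence ω)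
    (e : ℕ → S.WordMetricSpace) :
    ¬ IsSemilocallySimplyConnected (AsymptoticCone S.WordMetricSpace ω d e) ∧
    ∀ x₀ : AsymptoticCone S.WordMetricSpace ω d e,
      ¬ IsSimpleGroup (FundamentalGroup (AsymptoticCone S.WordMetricSpace ω d e) x₀) ∧
      (∀ (ι : Type*)
          (H : ι → Subgroup (FundamentalGroup (AsymptoticCone S.WordMetricSpace ω d e) x₀)),
          IsInternalFreeProduct H → ∃ i, ¬ IsFreeGroup (H i) ∧ Uncountable (H i)) ∧
      ∃ F : Subgroup (FundamentalGroup (AsymptoticCone S.WordMetricSpace ω d e) x₀),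
        IsFreeGroup F ∧ Uncountable F := by
  have hB := IsBaumslagSolitar.presentedGroup p q
  rcases hpq.lt_or_gt with h | h
  · exact hB.asymptoticCone hp h S ω d e
  · exact hB.swap.asymptoticCone hq h S ω d e
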